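/- Let $S^2$ be the unit sphere with round metric $h_{AB}$, volume form $\epsilon_{AB}$ and Levi-Civita derivative $D_A=(\cdot)_{||A}$; put $D^2=D_AD^A$ and raise and lower indices with $h$. All integrals are over $S^2$ with the standard area measure, and all fields are smooth. The data on null infinity are, for retarded times $u$ in an open set $I\subseteq\mathbb R$, a symmetric traceless tensor field $\chi_{AB}$ (the shear), a function $m$ and a one-form $N_A$ on $S^2$, all depending on $(u,x^A)$; a dot denotes $\partial_u$. For a function $f$ on $S^2$, under the supertranslation $u\mapsto u-f(x^A)$ the data transform (all quantities being taken at the same point of null infinity) as $$\chi_{AB}\mapsto\chi_{AB}-2f_{||AB}+h_{AB}D^2f,$$ $$m\mapsto m+\tfrac12\dot\chi^{AB}{}_{||B}f_{||A}+\tfrac14\dot\chi^{AB}f_{||AB}+\tfrac14\ddot\chi^{AB}f_{||A}f_{||B},$$ $$N_A\mapsto N_A-mf_{||A}+\tfrac14f_{||C}\chi_{AB}{}^{||BC}-\tfrac14f_{||C}\chi^{CB}{}_{||BA}+\tfrac14\dot\chi_{AB}{}^{||B}f_{||C}f^{||C}-\tfrac14\dot\chi^{BC}\chi_{AB}f_{||C}-\tfrac16\ddot\chi^{BC}f_{||B}f_{||C}f_{||A}-\tfrac12\dot\chi^{BC}{}_{||C}f_{||B}f_{||A}+\tfrac1{12}\ddot\chi_{AB}f^{||B}f_{||C}f^{||C}.$$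 Let $n$ be a linear combination of the $l=1$ spherical harmonics. The proposed angular momentum at retarded time $u$ is $$J=-\frac1{8\pi}\int_{S^2}\Big(3N_A+\tfrac14\chi_{AB}\chi^{BC}{}_{||C}\Big)\epsilon^{AD}n_{||D}+\frac3{8\pi}\int_{S^2}m\,\epsilon^{AD}n_{||D}c_{||A},$$ where $c$ is the unique solution of $D^2(D^2+2)c=\chi_{AB}{}^{||BA}$ without $l=0,1$ parts. Let $c,b$ be the potentials of $\chi$ at time $u$, that is, the smooth functions without $l=0,1$ parts such that $$\chi_{AB}=2c_{||AB}-h_{AB}D^2c+\epsilon_{AC}b^{||C}{}_{||B}+\epsilon_{BC}b^{||C}{}_{||A}$$ (this $c$ is the one in the definition of $J$). **Theorem.** Suppose that $\dot\chi=0$ on $I$, that $f$ is smooth, and that $\int_{S^2} f\,n_{||A}D^AD^2(D^2+2)b=0$. If $f$ has no $l=1$ part (that is, $f$ contains no spatial translation), then $J$ is invariant under the supertranslation $u\mapsto u-f(x^A)$: its value at $u$ computed from the transformed data, including their own potential, equals its value computed from the original data. Moreover, for every smooth $f$ satisfying the orthogonality condition, with or without an $l=1$ part, the same equality holds if on the transformed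 side the potential $c$ is replaced by $c-f$. -/

import Mathlib

open MeasureTheory Set
open scoped Manifold ContDiff

noncomputable section

namespace NullInfinity

/-!
### Tensor calculus on the round unit sphere

Tensor fields on `S²` are written through their Cartesian components: a tensor field of rank `k` is
a function of the point and of `k` indices in `Fin 3` that is annihilated by the position vector in
each index.  In these components the round metric is the projection `δ i j - x i * x j`, raising an
index does nothing, and a contraction is a sum over `Fin 3`.
-/

/-- Euclidean three-space. -/
abbrev E3 := EuclideanSpace ℝ (Fin 3)

/-- The unit two-sphere in Euclidean three-space. -/
abbrev S2 := Metric.sphere (0 : E3) 1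

/-- A point of the sphere, used only as the value of `radial` at the origin. -/
def northPole : S2 := ⟨EuclideanSpace.single 2 1, by simp⟩

/-- Radial projection `y ↦ y / ‖y‖` onto the sphere (its value at `0` plays no role). -/
def radial (y : E3) : S2 :=
  if h : y = 0 then northPole
  else ⟨‖y‖⁻¹ • y, by
    rw [mem_sphere_zero_iff_norm, norm_smul, norm_inv, norm_norm,
      inv_mul_cancel₀ (norm_ne_zero_iff.mpr h)]⟩

/-- Smooth real functions on the sphere. -/
def Smooth (F : S2 → ℝ) : Prop := ContMDiff (𝓡 2) 𝓘(ℝ, ℝ) ∞ F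

/-- The `i`-th Cartesian component of the tangential gradient of `F`: the derivative at `x`, in the
direction of the `i`-th basis vector, of the extension of `F` that is constant along rays. -/
def pd (F : S2 → ℝ) (i : Fin 3) (x : S2) : ℝ :=
  fderiv ℝ (fun y : E3 => F (radial y)) (x : E3) (EuclideanSpace.single i 1)

/-- The round metric `h_{ij}`, which is also the projection onto the tangent plane at `x`. -/
def met (x : S2) (i j : Fin 3) : ℝ := (if i = j then 1 else 0) - (x : E3) i * (x : E3) j

/-- The volume form `ε_{ij}` of the round metric, `ε(v, w) = det (x, v, w)`. -/
def eps (x : S2) (i j : Fin 3) : ℝ :=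
  (Matrix.of ![fun k => (x : E3) k, Pi.single i 1, Pi.single j 1]).det

/-- The differential `F_{||i}` of a function. -/
def grad (F : S2 → ℝ) (x : S2) (i : Fin 3) : ℝ := pd F i x

/-- The Levi-Civita covariant derivative `v_{i||j}` of a one-form: the tangential projection of the
tangential derivative. -/
def cov1 (v : S2 → Fin 3 → ℝ) (x : S2) (i j : Fin 3) : ℝ :=
  ∑ a, met x i a * pd (fun y => v y a) j x

/-- The Levi-Civita covariant derivative `T_{ij||k}` of a tensor field of rank two. -/
def cov2 (T : S2 → Fin 3 → Fin 3 → ℝ) (x : S2) (i j k : Fin 3) : ℝ :=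
  ∑ a, ∑ b, met x i a * met x j b * pd (fun y => T y a b) k x

/-- The second covariant derivative `F_{||ij}` of a function. -/
def hess (F : S2 → ℝ) : S2 → Fin 3 → Fin 3 → ℝ := cov1 (grad F)

/-- The Laplacian `D² F`. -/
def lap (F : S2 → ℝ) (x : S2) : ℝ := ∑ i, hess F x i i

/-- The operator `D² (D² + 2)`. -/
def lapLap (F : S2 → ℝ) : S2 → ℝ := lap (fun x => lap F x + 2 * F x)

/-- The divergence `T_{ij}^{||j}` of a tensor field of rank two. -/
def div2 (T : S2 → Fin 3 → Fin 3 → ℝ) (x : S2) (i : Fin 3) : ℝ := ∑ j, cov2 T x i j j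

/-- The double divergence `T_{ij}^{||ji}`. -/
def divdiv (T : S2 → Fin 3 → Fin 3 → ℝ) (x : S2) : ℝ := ∑ i, cov1 (div2 T) x i i

/-- Integration over the sphere with respect to the standard area measure (of total mass `4π`). -/
def sint (F : S2 → ℝ) : ℝ := ∫ x, F x ∂(volume : Measure E3).toSphere

/-- Linear combinations of the spherical harmonics with `l = 1`: restrictions of linear functions. -/
def IsDipole (n : S2 → ℝ) : Prop := ∃ a : E3, ∀ x : S2, n x = inner ℝ a (x : E3)

/-- `F` has no `l = 1` part. -/
def NoDipolePart (F : S2 → ℝ) : Prop := ∀ n, IsDipole n → sint (fun x => F x * n x) = 0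

/-- `F` has no `l = 0` part. -/
def NoMonopolePart (F : S2 → ℝ) : Prop := sint F = 0

/-!
### Data on null infinity
-/

/-- The data on null infinity: shear tensor `χ_{AB}`, mass aspect `m` and angular aspect `N_A`, as
functions of the retarded time and of the point of the sphere. -/
structure ScriData where
  χ : ℝ → S2 → Fin 3 → Fin 3 → ℝ
  m : ℝ → S2 → ℝ
  N : ℝ → S2 → Fin 3 → ℝ

/-- The data are smooth for retarded times in `I`, and there `χ` is a symmetric traceless tensor
field and `N` a one-form on the sphere. -/
structure ScriData.IsRegularOn (D : ScriData) (I : Set ℝ) : Prop where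
  smooth_χ : ∀ i j, ContMDiffOn (𝓘(ℝ, ℝ).prod (𝓡 2)) 𝓘(ℝ, ℝ) ∞
    (fun p : ℝ × S2 => D.χ p.1 p.2 i j) (I ×ˢ univ)
  smooth_m : ContMDiffOn (𝓘(ℝ, ℝ).prod (𝓡 2)) 𝓘(ℝ, ℝ) ∞
    (fun p : ℝ × S2 => D.m p.1 p.2) (I ×ˢ univ)
  smooth_N : ∀ i, ContMDiffOn (𝓘(ℝ, ℝ).prod (𝓡 2)) 𝓘(ℝ, ℝ) ∞
    (fun p : ℝ × S2 => D.N p.1 p.2 i) (I ×ˢ univ)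
  symm_χ : ∀ u ∈ I, ∀ x i j, D.χ u x i j = D.χ u x j i
  trace_χ : ∀ u ∈ I, ∀ x, ∑ i, D.χ u x i i = 0
  tangent_χ : ∀ u ∈ I, ∀ x i, ∑ j, D.χ u x i j * (x : E3) j = 0
  tangent_N : ∀ u ∈ I, ∀ x, ∑ i, D.N u x i * (x : E3) i = 0

/-- The derivative `χ̇` of the shear tensor in retarded time. -/
def ScriData.χdot (D : ScriData) (u : ℝ) (x : S2) (i j : Fin 3) : ℝ :=
  deriv (fun s => D.χ s x i j) u

/-- The second derivative `χ̈` of the shear tensor in retarded time. -/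
def ScriData.χddot (D : ScriData) (u : ℝ) (x : S2) (i j : Fin 3) : ℝ :=
  deriv (fun s => D.χdot s x i j) u

/-- The data after the supertranslation `u ↦ u - f`.  The new data are given as functions on the same
points of null infinity, which are labelled by their original coordinates `(u, x)`. -/
def ScriData.supertranslate (D : ScriData) (f : S2 → ℝ) : ScriData where
  χ u x i j := D.χ u x i j - 2 * hess f x i j + met x i j * lap f x
  m u x := D.m u x
    + 1 / 2 * ∑ i, div2 (D.χdot u) x i * grad f x i
    + 1 / 4 * ∑ i, ∑ j, D.χdot u x i j * hess f x i j
    + 1 / 4 * ∑ i, ∑ j, D.χddot u x i j * grad f x i * grad f x j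
  N u x i := D.N u x i - D.m u x * grad f x i
    + 1 / 4 * ∑ k, grad f x k * cov1 (div2 (D.χ u)) x i k
    - 1 / 4 * ∑ k, grad f x k * cov1 (div2 (D.χ u)) x k i
    + 1 / 4 * div2 (D.χdot u) x i * ∑ k, grad f x k * grad f x k
    - 1 / 4 * ∑ j, ∑ k, D.χdot u x j k * D.χ u x i j * grad f x k
    - 1 / 6 * (∑ j, ∑ k, D.χddot u x j k * grad f x j * grad f x k) * grad f x i
    - 1 / 2 * (∑ j, div2 (D.χdot u) x j * grad f x j) * grad f x i
    + 1 / 12 * (∑ j, D.χddot u x i j * grad f x j) * ∑ k, grad f x k * grad f x k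

/-!
### Potentials and angular momentum
-/

/-- `c` and `b` are the potentials of the tensor field `T`: smooth functions without `l = 0, 1` parts
such that `T_{AB} = 2 c_{||AB} - h_{AB} D² c + ε_{AC} b^{||C}_{||B} + ε_{BC} b^{||C}_{||A}`. -/
structure ArePotentials (T : S2 → Fin 3 → Fin 3 → ℝ) (c b : S2 → ℝ) : Prop where
  smooth_c : Smooth c
  smooth_b : Smooth b
  noMonopole_c : NoMonopolePart c
  noDipole_c : NoDipolePart c
  noMonopole_b : NoMonopolePart b
  noDipole_b : NoDipolePart b
  eq : ∀ x i j, T x i j = 2 * hess c x i j - met x i j * lap c x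
    + ∑ k, eps x i k * hess b x k j + ∑ k, eps x j k * hess b x k i

/-- `c` is a smooth solution of `D² (D² + 2) c = T_{AB}^{||BA}` without `l = 0, 1` parts. -/
structure IsElectricPotential (T : S2 → Fin 3 → Fin 3 → ℝ) (c : S2 → ℝ) : Prop where
  smooth : Smooth c
  noMonopole : NoMonopolePart c
  noDipole : NoDipolePart c
  eq : ∀ x, lapLap c x = divdiv T x

open Classical in
/-- The (unique) solution `c` of `D² (D² + 2) c = T_{AB}^{||BA}` without `l = 0, 1` parts. -/
def electricPotential (T : S2 → Fin 3 → Fin 3 → ℝ) : S2 → ℝ :=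
  if hc : ∃ c, IsElectricPotential T c then hc.choose else 0

/-- The angular momentum `J^(CJK)`, as a functional of the data on the sphere. -/
def angMomCJK (χ : S2 → Fin 3 → Fin 3 → ℝ) (N : S2 → Fin 3 → ℝ) (n : S2 → ℝ) : ℝ :=
  -(1 / (8 * Real.pi)) * sint (fun x => ∑ i, ∑ k,
    (3 * N x i + 1 / 4 * ∑ j, χ x i j * div2 χ x j) * eps x i k * grad n x k)

/-- The proposed angular momentum, formed with a given function `c`:
`J^(CJK) + 3 / (8π) ∫ m ε^{AD} n_{||D} c_{||A}`. -/
def angMomWith (χ : S2 → Fin 3 → Fin 3 → ℝ) (m : S2 → ℝ) (N : S2 → Fin 3 → ℝ) (n c : S2 → ℝ) : ℝ :=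
  angMomCJK χ N n
    + 3 / (8 * Real.pi) * sint (fun x => m x * ∑ i, ∑ k, eps x i k * grad n x k * grad c x i)

/-- The proposed angular momentum `J` of the data at retarded time `u`, for the dipole function `n`. -/
def ScriData.angMom (D : ScriData) (n : S2 → ℝ) (u : ℝ) : ℝ :=
  angMomWith (D.χ u) (D.m u) (D.N u) n (electricPotential (D.χ u))

end NullInfinity

end

noncomputable section

namespace NullInfinity

/-! Since `χ̇` vanishes on an open set, so does `χ̈`. Then `m` is unchanged, `N_A` changes by `-m
f_A` and a quarter of the curl of `V = div χ` contracted with `∇f`, and `χ` loses the shear of `f`.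
Let `Y = ε∇n` be the rotation field. Replacing `c` by `c - f` in the mass integral cancels the
`m`-term coming from `N_A`.

What remains is quadratic in the shear potentials and `f`. With `P = (D²+2)c`, `Q = (D²+2)b`, `F =
(D²+2)f` one has `V = dP + *dQ`. Because `Y` is Killing and `∇n` is conformal Killing, derivatives
can be moved off the shear tensors. The terms in `P` and `F` alone become integrals of `Y(PF)` and
`Y(F²)`, which vanish. The terms in `Q` add up to `-∫ f ∇n·∇D²Q`, exactly the integral required to
be zero. This is `SphereCalculus.I_shear_variation`.

For the potential of the transformed data, `D²(D²+2)` has only `l = 0, 1` functions in its kernel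
(`eq_zero_of_lapLap`), so the potential is unique. If `f` has no `l = 1` part, it is `c - f` plus
the mean of `f`, and a constant does not affect `J`.

The tensor identities are proved in the abstract ring setting `SphereCalculus` and transferred to
smooth functions on `S²` through `sph` and the evaluations `ev`. -/

theorem fact_finrank_E3 : Fact (Module.finrank ℝ E3 = 2 + 1) := ⟨finrank_euclideanSpace_fin⟩

attribute [local instance] fact_finrank_E3

/-! ### Radial extension and tangential derivatives. -/

theorem coe_radial {y : E3} (hy : y ≠ 0) : (radial y : E3) = ‖y‖⁻¹ • y := by
  simp [radial, hy]

theorem coe_ne_zero (x : S2) : (x : E3) ≠ 0 := ne_zero_of_mem_unit_sphere x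

theorem norm_coe (x : S2) : ‖(x : E3)‖ = 1 := norm_eq_of_mem_sphere x

theorem radial_smul {t : ℝ} (ht : 0 < t) (y : E3) (hy : y ≠ 0) : radial (t • y) = radial y := by
  apply Subtype.ext
  rw [coe_radial hy, coe_radial (smul_ne_zero ht.ne' hy), norm_smul, Real.norm_of_nonneg ht.le,
    smul_smul, mul_inv, mul_comm t⁻¹, mul_assoc, inv_mul_cancel₀ ht.ne', mul_one]

theorem radial_coe (x : S2) : radial (x : E3) = x := by
  apply Subtype.ext
  rw [coe_radial (coe_ne_zero x), norm_coe]; simp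

theorem sum_coe_sq (x : S2) : ∑ i, (x : E3) i * (x : E3) i = 1 := by
  have h := EuclideanSpace.real_norm_sq_eq (x : E3)
  rw [norm_coe] at h
  simp only [← pow_two, ← h]; norm_num

/-- The extension of a smooth function that is constant along rays is smooth off the origin. -/
theorem Smooth.contDiffAt_radial {F : S2 → ℝ} (hF : Smooth F) {y : E3} (hy : y ≠ 0) :
    ContDiffAt ℝ ∞ (fun z : E3 => F (radial z)) y := by
  let U : TopologicalSpace.Opens E3 := ⟨{0}ᶜ, isOpen_compl_singleton⟩
  have h1 : ContMDiff 𝓘(ℝ, E3) 𝓘(ℝ, E3) ∞ (fun z : U => ‖(z : E3)‖⁻¹ • (z : E3)) := by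
    intro z
    refine (contMDiffAt_subtype_iff (f := fun z : E3 => ‖z‖⁻¹ • z)).mpr ?_
    apply ContDiffAt.contMDiffAt
    have hz : (z : E3) ≠ 0 := z.2
    exact ((contDiffAt_norm ℝ hz).inv (norm_ne_zero_iff.mpr hz)).smul contDiffAt_id
  have h2 : ∀ z : U, ‖(z : E3)‖⁻¹ • (z : E3) ∈ Metric.sphere (0 : E3) 1 := fun z => by
    rw [← coe_radial z.2]; exact (radial _).2
  have h3 := ContMDiff.codRestrict_sphere (n := 2) h1 h2
  have h4 : ContMDiff 𝓘(ℝ, E3) 𝓘(ℝ, ℝ) ∞ (fun z : U => F (radial z)) := by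
    have := ContMDiff.comp hF h3
    convert this using 2 with z
    congr 1
    exact Subtype.ext (coe_radial z.2)
  have h5 := h4 ⟨y, hy⟩
  exact (contMDiffAt_subtype_iff (f := fun z : E3 => F (radial z)) (x := (⟨y, hy⟩ : U))).mp h5
    |>.contDiffAt

theorem Smooth.differentiableAt_radial {F : S2 → ℝ} (hF : Smooth F) {y : E3} (hy : y ≠ 0) :
    DifferentiableAt ℝ (fun z : E3 => F (radial z)) y :=
  (hF.contDiffAt_radial hy).differentiableAt (by simp)

/-- A function on the sphere is smooth if it is the restriction of a function that is smooth
near the sphere. -/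
theorem smooth_of_contDiffAt {G : E3 → ℝ} (hG : ∀ x : S2, ContDiffAt ℝ ∞ G x) :
    Smooth (fun x : S2 => G x) := fun x =>
  ContMDiffAt.comp (I' := 𝓘(ℝ, E3)) x (hG x).contMDiffAt (contMDiff_coe_sphere (n := 2)).contMDiffAt

theorem smooth_pd {F : S2 → ℝ} (hF : Smooth F) (i : Fin 3) : Smooth (pd F i) := by
  refine smooth_of_contDiffAt (G := fun y => fderiv ℝ (fun y : E3 => F (radial y)) y
    (EuclideanSpace.single i 1)) fun x => ?_
  exact ((hF.contDiffAt_radial (coe_ne_zero x)).fderiv_right (m := ∞) (by simp)).clm_apply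
    contDiffAt_const

theorem smooth_coord (i : Fin 3) : Smooth (fun x : S2 => (x : E3) i) :=
  smooth_of_contDiffAt (G := fun y => y i) fun x => by fun_prop

theorem apply_eq_sum (L : E3 →L[ℝ] ℝ) (v : E3) :
    L v = ∑ i, v i * L (EuclideanSpace.single i 1) := by
  conv_lhs => rw [← (EuclideanSpace.basisFun (Fin 3) ℝ).sum_repr v]
  simp [map_sum]

theorem hasFDerivAt_norm {y : E3} (hy : y ≠ 0) :
    HasFDerivAt (fun y : E3 => ‖y‖) (‖y‖⁻¹ • innerSL ℝ y) y := by
  have h := (hasStrictFDerivAt_norm_sq y).hasFDerivAt.sqrt (by simpa using hy)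
  have h' : (fun y : E3 => √(‖y‖ ^ 2)) = fun y => ‖y‖ := by
    funext y; exact Real.sqrt_sq (norm_nonneg y)
  rw [h', Real.sqrt_sq (norm_nonneg y)] at h
  refine h.congr_fderiv ?_
  ext v
  simp
  ring

theorem hasFDerivAt_norm_coe (x : S2) :
    HasFDerivAt (fun y : E3 => ‖y‖) (innerSL ℝ (x : E3)) (x : E3) := by
  simpa [norm_coe] using hasFDerivAt_norm (coe_ne_zero x)

theorem fderiv_radial_smul (F : S2 → ℝ) {t : ℝ} (ht : 0 < t) {y : E3} (hy : y ≠ 0) :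
    fderiv ℝ (fun z : E3 => F (radial z)) (t • y) =
      t⁻¹ • fderiv ℝ (fun z : E3 => F (radial z)) y := by
  have h : (fun z : E3 => F (radial z)) =ᶠ[nhds y] (fun z => (fun z : E3 => F (radial z)) (t • z)) := by
    filter_upwards [isOpen_compl_singleton.mem_nhds hy] with z hz
    simp only [radial_smul ht z hz]
  rw [h.fderiv_eq, fderiv_comp_smul (f := fun z : E3 => F (radial z)), smul_smul, inv_mul_cancel₀ ht.ne', one_smul]

/-- The derivative of a function homogeneous of degree zero has degree `-1`; the factor `‖y‖`
compensates. This expresses the ray-constant extension of `pd F i` by an ordinary derivative, so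
that it can be differentiated again. -/
theorem pd_radial (F : S2 → ℝ) (i : Fin 3) {y : E3} (hy : y ≠ 0) :
    pd F i (radial y) =
      ‖y‖ * fderiv ℝ (fun z : E3 => F (radial z)) y (EuclideanSpace.single i 1) := by
  rw [pd, coe_radial hy, fderiv_radial_smul F (inv_pos.mpr (norm_pos_iff.mpr hy)) hy]
  simp

/-- Euler's relation: the extension is constant along the ray through `x`. -/
theorem sum_coord_mul_pd {F : S2 → ℝ} (hF : Smooth F) (x : S2) :
    ∑ i, (x : E3) i * pd F i x = 0 := by
  have hd := (hF.differentiableAt_radial (coe_ne_zero x)).hasFDerivAt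
  have h1 : ∑ i, (x : E3) i * pd F i x = fderiv ℝ (fun z : E3 => F (radial z)) x (x : E3) := by
    exact (apply_eq_sum _ _).symm
  rw [h1]
  have h2 : HasDerivAt (fun t : ℝ => (t • (x : E3))) (x : E3) 1 := by
    simpa using (hasDerivAt_id (1 : ℝ)).smul_const (x : E3)
  have h3 : HasDerivAt (fun t : ℝ => F (radial (t • (x : E3))))
      (fderiv ℝ (fun z : E3 => F (radial z)) x (x : E3)) 1 := by
    have hd' : HasFDerivAt (fun z : E3 => F (radial z))
      (fderiv ℝ (fun z : E3 => F (radial z)) x) ((1 : ℝ) • (x : E3)) := by rwa [one_smul]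
    exact hd'.comp_hasDerivAt (1 : ℝ) h2
  have h4 : (fun t : ℝ => F (radial (t • (x : E3)))) =ᶠ[nhds 1] fun _ => F (radial x) := by
    filter_upwards [isOpen_Ioi.mem_nhds (zero_lt_one (α := ℝ))] with t ht
    rw [radial_smul ht _ (coe_ne_zero x)]
  rw [← h3.deriv, h4.deriv_eq, deriv_const]

theorem pd_coord (i j : Fin 3) (x : S2) :
    pd (fun x : S2 => (x : E3) i) j x = (if i = j then 1 else 0) - (x : E3) i * (x : E3) j := by
  have hx := coe_ne_zero x
  have h1 : (fun y : E3 => (radial y : E3) i) =ᶠ[nhds (x : E3)] fun y => ‖y‖⁻¹ * y i := by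
    filter_upwards [isOpen_compl_singleton.mem_nhds hx] with y hy
    simp [coe_radial hy]
  have hn := hasFDerivAt_norm_coe x
  have hi : HasFDerivAt (fun y : E3 => ‖y‖⁻¹) (-(innerSL ℝ (x : E3))) (x : E3) := by
    have := (hasDerivAt_inv (x := ‖(x : E3)‖) (by rw [norm_coe]; norm_num)).comp_hasFDerivAt _ hn
    refine this.congr_fderiv ?_
    ext v; simp
  have hc : HasFDerivAt (fun y : E3 => y i) (EuclideanSpace.proj i : E3 →L[ℝ] ℝ) (x : E3) :=
    (EuclideanSpace.proj i : E3 →L[ℝ] ℝ).hasFDerivAt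
  rw [pd, h1.fderiv_eq, (hi.fun_mul hc).fderiv]
  simp [PiLp.inner_apply, eq_comm]
  ring

theorem pd_add {F G : S2 → ℝ} (hF : Smooth F) (hG : Smooth G) (i : Fin 3) (x : S2) :
    pd (fun x => F x + G x) i x = pd F i x + pd G i x := by
  rw [pd, fderiv_fun_add (hF.differentiableAt_radial (coe_ne_zero x))
    (hG.differentiableAt_radial (coe_ne_zero x))]; rfl

theorem pd_mul {F G : S2 → ℝ} (hF : Smooth F) (hG : Smooth G) (i : Fin 3) (x : S2) :
    pd (fun x => F x * G x) i x = F x * pd G i x + G x * pd F i x := by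
  rw [pd, fderiv_fun_mul (hF.differentiableAt_radial (coe_ne_zero x))
    (hG.differentiableAt_radial (coe_ne_zero x)), radial_coe]; rfl

theorem pd_const (c : ℝ) (i : Fin 3) (x : S2) : pd (fun _ => c) i x = 0 := by
  simp [pd]

/-- The ambient second derivative is symmetric; only the derivative of the factor `‖y‖` from
`pd_radial` survives antisymmetrization. -/
theorem pd_pd_sub {F : S2 → ℝ} (hF : Smooth F) (i j : Fin 3) (x : S2) :
    pd (pd F i) j x - pd (pd F j) i x = (x : E3) j * pd F i x - (x : E3) i * pd F j x := by
  have hx := coe_ne_zero x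
  have hcd := hF.contDiffAt_radial hx
  have hd : DifferentiableAt ℝ (fderiv ℝ (fun z : E3 => F (radial z))) (x : E3) :=
    (hcd.fderiv_right (m := 1) (by norm_cast)).differentiableAt (by simp)
  have key : ∀ i j, pd (pd F i) j x = (x : E3) j * pd F i x +
      fderiv ℝ (fderiv ℝ (fun z : E3 => F (radial z))) x (EuclideanSpace.single j 1)
        (EuclideanSpace.single i 1) := by
    intro i j
    have h1 : (fun y : E3 => pd F i (radial y)) =ᶠ[nhds (x : E3)] fun y => ‖y‖ *
        fderiv ℝ (fun z : E3 => F (radial z)) y (EuclideanSpace.single i 1) := by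
      filter_upwards [isOpen_compl_singleton.mem_nhds hx] with y hy using pd_radial F i hy
    have hn := hasFDerivAt_norm_coe x
    have hh := hd.hasFDerivAt.clm_apply
      (hasFDerivAt_const (EuclideanSpace.single i (1 : ℝ) : E3) (x : E3))
    rw [pd, h1.fderiv_eq, (hn.fun_mul hh).fderiv]
    simp [PiLp.inner_apply, pd]
    ring
  have hs := (hcd.isSymmSndFDerivAt (by simpa using by norm_cast)) (EuclideanSpace.single i 1)
    (EuclideanSpace.single j 1)
  rw [key i j, key j i, hs]
  ring

theorem constant_of_pd_eq_zero {F : S2 → ℝ} (hF : Smooth F) (h : ∀ i x, pd F i x = 0) :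
    ∃ k, ∀ x, F x = k := by
  have h0 : IsPreconnected ({0}ᶜ : Set E3) :=
    (isConnected_compl_singleton_of_one_lt_rank (by
      rw [← Module.finrank_eq_rank, finrank_euclideanSpace_fin]; norm_num) 0).isPreconnected
  obtain ⟨k, hk⟩ := isOpen_compl_singleton.exists_is_const_of_fderiv_eq_zero h0
    (f := fun z : E3 => F (radial z)) (𝕜 := ℝ)
    (fun y hy => (hF.differentiableAt_radial hy).differentiableWithinAt) (by
      intro y hy
      ext v
      have h1 := fun i => pd_radial F i hy
      simp only [h, zero_eq_mul, norm_eq_zero] at h1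
      rw [apply_eq_sum]
      exact Finset.sum_eq_zero fun i _ => by rw [(h1 i).resolve_left hy, mul_zero])
  exact ⟨k, fun x => by have := hk x (coe_ne_zero x); rwa [radial_coe] at this⟩

/-! ### Integration on the sphere and the divergence theorem. -/

theorem Smooth.continuous {F : S2 → ℝ} (hF : Smooth F) : Continuous F :=
  ContMDiff.continuous hF

theorem Smooth.integrable {F : S2 → ℝ} (hF : Smooth F) :
    Integrable F (volume : Measure E3).toSphere :=
  hF.continuous.integrable_of_hasCompactSupport (HasCompactSupport.of_compactSpace F)

/-- Integration in polar coordinates of a function of the form `p (‖y‖) * F (y / ‖y‖)`. -/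
theorem integral_polar {H : E3 → ℝ} {p : ℝ → ℝ} {F : S2 → ℝ}
    (h : ∀ y, y ≠ 0 → H y = p ‖y‖ * F (radial y)) :
    ∫ y, H y = (∫ r in Ioi (0 : ℝ), r ^ 2 * p r) * sint F := by
  have hmp := (volume : Measure E3).measurePreserving_homeomorphUnitSphereProd
  have hdim : Module.finrank ℝ E3 = 3 := finrank_euclideanSpace_fin
  calc ∫ y, H y = ∫ y : ({(0)}ᶜ : Set E3), H y ∂((volume : Measure E3).comap (↑)) := by
        rw [integral_subtype_comap (measurableSet_singleton _).compl H, restrict_compl_singleton]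
    _ = ∫ y : ({(0)}ᶜ : Set E3), (fun z : S2 × Ioi (0 : ℝ) => F z.1 * p z.2)
          (homeomorphUnitSphereProd E3 y) ∂((volume : Measure E3).comap (↑)) := by
        refine integral_congr_ae (Filter.Eventually.of_forall fun y => ?_)
        have hy : (y : E3) ≠ 0 := y.2
        have : (homeomorphUnitSphereProd E3 y).1 = radial (y : E3) :=
          Subtype.ext (by rw [coe_radial hy, homeomorphUnitSphereProd_apply_fst_coe])
        simp only [h y hy, this, homeomorphUnitSphereProd_apply_snd_coe, mul_comm]
    _ = ∫ z, (fun z : S2 × Ioi (0 : ℝ) => F z.1 * p z.2) z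
          ∂((volume : Measure E3).toSphere.prod (Measure.volumeIoiPow 2)) := by
        rw [hdim, show 3 - 1 = 2 from rfl] at hmp
        exact hmp.integral_comp (Homeomorph.measurableEmbedding _)
          (fun z : S2 × Ioi (0 : ℝ) => F z.1 * p z.2)
    _ = sint F * ∫ r : Ioi (0 : ℝ), p r ∂(Measure.volumeIoiPow 2) :=
        integral_prod_mul F (fun r : Ioi (0 : ℝ) => p r)
    _ = _ := by
        rw [mul_comm]
        congr 1
        simp only [Measure.volumeIoiPow, ENNReal.ofReal]
        rw [integral_withDensity_eq_integral_smul,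
          integral_subtype_comap measurableSet_Ioi fun a ↦ Real.toNNReal (a ^ 2) • p a]
        · refine setIntegral_congr_fun measurableSet_Ioi fun x hx ↦ ?_
          simp only [NNReal.smul_def, Real.coe_toNNReal _ (pow_nonneg (le_of_lt hx) 2), smul_eq_mul]
        · exact (measurable_subtype_coe.pow_const _).real_toNNReal

/-- A radial cutoff function. -/
def cutoff : ContDiffBump (2 : ℝ) := ⟨1 / 2, 1, by norm_num, by norm_num⟩

theorem cutoff_eq_zero {r : ℝ} (hr : r ≤ 1) : cutoff r = 0 :=
  cutoff.zero_of_le_dist (by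
    rw [Real.dist_eq, abs_of_nonpos (by linarith)]; simp only [cutoff]; linarith)

theorem integral_Ioi_of_eq_zero {g : ℝ → ℝ} (hg : ∀ r, r ≤ 0 → g r = 0) :
    ∫ r in Ioi (0 : ℝ), g r = ∫ r, g r :=
  setIntegral_eq_integral_of_forall_compl_eq_zero fun r hr => hg r (not_lt.mp hr)

theorem contDiff_cutoff : ContDiff ℝ 1 cutoff := cutoff.contDiff

theorem deriv_cutoff_eq_zero {r : ℝ} (hr : r < 1) : deriv cutoff r = 0 := by
  have : (cutoff : ℝ → ℝ) =ᶠ[nhds r] fun _ => 0 := by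
    filter_upwards [isOpen_Iio.mem_nhds hr] with s hs using cutoff_eq_zero (le_of_lt hs)
  rw [this.deriv_eq, deriv_const]

theorem integral_sq_mul_cutoff_div :
    ∫ r in Ioi (0 : ℝ), r ^ 2 * (cutoff r / r) = ∫ r, r * cutoff r := by
  rw [← integral_Ioi_of_eq_zero fun r hr => by rw [cutoff_eq_zero (by linarith), mul_zero]]
  refine setIntegral_congr_fun measurableSet_Ioi fun r hr => ?_
  have : r ≠ 0 := ne_of_gt hr
  field_simp

/-- Integration by parts against `r²`. The factor `-2` becomes the mean-curvature factor `2` in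
`sint_pd`. -/
theorem integral_sq_mul_deriv_cutoff :
    ∫ r in Ioi (0 : ℝ), r ^ 2 * deriv cutoff r = -2 * ∫ r in Ioi (0 : ℝ), r ^ 2 * (cutoff r / r) := by
  have hc := cutoff.hasCompactSupport
  have hcont := contDiff_cutoff.continuous
  have hcont' : Continuous (deriv cutoff) := contDiff_cutoff.continuous_deriv le_rfl
  rw [integral_sq_mul_cutoff_div, integral_Ioi_of_eq_zero fun r hr => by rw [deriv_cutoff_eq_zero (by linarith), mul_zero],
    integral_mul_deriv_eq_deriv_mul_of_integrable (u := fun r => r ^ 2) (u' := fun r => 2 * r)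
      (v := cutoff) (v' := deriv cutoff)]
  · rw [← integral_neg, ← integral_const_mul]
    congr 1; funext r; ring
  · intro r _; simpa using hasDerivAt_pow 2 r
  · intro r _; exact (contDiff_cutoff.differentiable one_ne_zero r).hasDerivAt
  · exact Continuous.integrable_of_hasCompactSupport (by fun_prop) (hc.deriv.mul_left)
  · exact Continuous.integrable_of_hasCompactSupport (by fun_prop) (hc.mul_left)
  · exact Continuous.integrable_of_hasCompactSupport (by fun_prop) (hc.mul_left)

theorem integral_cutoff_pos : 0 < ∫ r in Ioi (0 : ℝ), r ^ 2 * (cutoff r / r) := by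
  have hc := cutoff.hasCompactSupport
  have hcont := contDiff_cutoff.continuous
  rw [integral_sq_mul_cutoff_div]
  refine Continuous.integral_pos_of_hasCompactSupport_nonneg_nonzero (by fun_prop) hc.mul_left
    (fun r => ?_) (x := 2) ?_
  · rcases le_or_gt r 0 with hr | hr
    · simp [cutoff_eq_zero (show r ≤ 1 by linarith)]
    · exact mul_nonneg hr.le cutoff.nonneg
  · have : cutoff (2 : ℝ) = 1 := cutoff.one_of_mem_closedBall (by simp [cutoff])
    simp [this]

/-- The divergence theorem for the Cartesian components of the tangential gradient. -/
theorem sint_pd {F : S2 → ℝ} (hF : Smooth F) (i : Fin 3) :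
    sint (pd F i) = 2 * sint (fun x => (x : E3) i * F x) := by
  set e : E3 := EuclideanSpace.single i 1
  set g : E3 → ℝ := fun z => F (radial z)
  set φ : E3 → ℝ := fun y => cutoff ‖y‖
  have hφsupp : ∀ y ∈ tsupport φ, y ≠ 0 := by
    rintro y hy rfl
    have : (0 : E3) ∉ tsupport φ := by
      rw [notMem_tsupport_iff_eventuallyEq]
      filter_upwards [Metric.ball_mem_nhds (0 : E3) one_pos] with z hz
      exact cutoff_eq_zero (by simpa using (mem_ball_zero_iff.mp hz).le)
    exact this hy
  have hφc : HasCompactSupport φ := by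
    refine HasCompactSupport.of_support_subset_isCompact (isCompact_closedBall (0 : E3) 3) ?_
    intro y hy
    by_contra hcon
    simp only [mem_closedBall_zero_iff, not_le] at hcon
    exact hy (cutoff.zero_of_le_dist (by
      rw [Real.dist_eq, abs_of_nonneg (by linarith)]; simp only [cutoff]; linarith))
  have hnorm : ∀ y : E3, y ≠ 0 → ContDiffAt ℝ 1 φ y := fun y hy =>
    contDiff_cutoff.contDiffAt.comp y (contDiffAt_norm ℝ hy)
  have hφ0 : ∀ y : E3, ContDiffAt ℝ 1 φ y := by
    intro y
    by_cases hy : y = 0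
    · have : φ =ᶠ[nhds y] fun _ => 0 := by
        subst hy
        exact notMem_tsupport_iff_eventuallyEq.mp fun h => hφsupp 0 h rfl
      exact contDiffAt_const.congr_of_eventuallyEq this
    · exact hnorm y hy
  have hφC : ContDiff ℝ 1 φ := contDiff_iff_contDiffAt.mpr hφ0
  have hφ' : ∀ y : E3, y ≠ 0 → fderiv ℝ φ y e = deriv cutoff ‖y‖ * (radial y : E3) i := by
    intro y hy
    have h := (contDiff_cutoff.differentiable one_ne_zero ‖y‖).hasDerivAt.comp_hasFDerivAt y
      (hasFDerivAt_norm hy)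
    rw [show φ = (cutoff : ℝ → ℝ) ∘ fun y => ‖y‖ from rfl, h.fderiv, coe_radial hy]
    simp [e, PiLp.inner_apply]
  have hgc : ∀ y : E3, y ≠ 0 → ContDiffAt ℝ 1 g y := fun y hy =>
    (hF.contDiffAt_radial hy).of_le (by norm_cast)
  have cont_mul : ∀ a b : E3 → ℝ, Continuous a → tsupport a ⊆ tsupport φ →
      (∀ y : E3, y ≠ 0 → ContinuousAt b y) → Integrable (fun y => a y * b y) := by
    intro a b ha hs hb
    refine Continuous.integrable_of_hasCompactSupport ?_
      ((hφc.mono' (subset_closure.trans hs)).mul_right)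
    rw [continuous_iff_continuousAt]
    intro y
    by_cases hy : y = 0
    · have : (fun y => a y * b y) =ᶠ[nhds y] fun _ => 0 := by
        have h0 := notMem_tsupport_iff_eventuallyEq.mp fun h => hφsupp y (hs h) hy
        filter_upwards [h0] with z hz
        rw [hz]; simp
      exact continuousAt_const.congr this.symm
    · exact ha.continuousAt.mul (hb y hy)
  -- Integration by parts in space against a radial cutoff vanishing near the origin, where the
  -- extension of `F` is singular. In polar coordinates each side is a radial constant times an
  -- integral over the sphere, and the positive radial constant cancels.
  have ibp := integral_mul_fderiv_eq_neg_fderiv_mul_of_integrable (μ := (volume : Measure E3))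
    (f := φ) (g := g) (v := e)
    (cont_mul _ _ ((hφC.continuous_fderiv one_ne_zero).clm_apply continuous_const)
      ((tsupport_fderiv_apply_subset ℝ e)) fun y hy => (hgc y hy).continuousAt)
    (cont_mul _ _ hφC.continuous subset_rfl fun y hy =>
      (((hgc y hy).fderiv_right (m := 0) (by simp)).clm_apply contDiffAt_const).continuousAt)
    (cont_mul _ _ hφC.continuous subset_rfl fun y hy => (hgc y hy).continuousAt)
    (fun y _ => (hφC.differentiable one_ne_zero) y)
    (fun y hy => (hgc y (hφsupp y hy)).differentiableAt one_ne_zero)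
  rw [integral_polar (p := fun r => cutoff r / r) (F := pd F i) ?_,
    integral_polar (p := deriv cutoff) (F := fun x => (x : E3) i * F x) ?_,
    integral_sq_mul_deriv_cutoff] at ibp
  · refine mul_left_cancel₀ integral_cutoff_pos.ne' ?_
    linarith
  · intro y hy
    rw [hφ' y hy, mul_assoc]
  · intro y hy
    rw [pd_radial F i hy]
    have := norm_ne_zero_iff.mpr hy
    field_simp
    rfl

/-! ### Tensor calculus on the sphere as algebra in a commutative ring with derivations. -/

/-- The algebraic rules of calculus on the unit sphere in Cartesian components: `d i` are the
components of the tangential gradient, `X i` the coordinates, and `I` is the integral. -/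
structure SphereCalculus (A : Type*) [CommRing A] [Algebra ℝ A] where
  X : Fin 3 → A
  d : Fin 3 → Derivation ℝ A A
  I : A →ₗ[ℝ] ℝ
  sum_X_sq : ∑ i, X i * X i = 1
  d_X' : ∀ i j, d j (X i) = (if i = j then 1 else 0) - X i * X j
  sum_X_d : ∀ F, ∑ i, X i * d i F = 0
  comm : ∀ i j F, d j (d i F) - d i (d j F) = X j * d i F - X i * d j F
  I_d : ∀ i F, I (d i F) = 2 * I (X i * F)

namespace SphereCalculus

variable {A : Type*} [CommRing A] [Algebra ℝ A] (S : SphereCalculus A)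

/-- The round metric. -/
def met (i j : Fin 3) : A := (if i = j then 1 else 0) - S.X i * S.X j

/-- The volume form. -/
def eps (i j : Fin 3) : A := (Matrix.of ![S.X, Pi.single i 1, Pi.single j 1]).det

/-- The covariant derivative of a one-form. -/
def cov1 (v : Fin 3 → A) (i j : Fin 3) : A := ∑ a, S.met i a * S.d j (v a)

/-- The second covariant derivative of a function. -/
def hess (F : A) : Fin 3 → Fin 3 → A := S.cov1 fun i => S.d i F

/-- The Laplacian. -/
def lap (F : A) : A := ∑ i, S.hess F i i

/-- The divergence of a tensor field of rank two. -/
def div2 (T : Fin 3 → Fin 3 → A) (i : Fin 3) : A :=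
  ∑ j, ∑ a, ∑ b, S.met i a * S.met j b * S.d j (T a b)

/-- Twice the traceless part of the second covariant derivative. -/
def shear (F : A) (i j : Fin 3) : A := 2 * S.hess F i j - S.met i j * S.lap F

/-- The symmetrized dual of the second covariant derivative. -/
def dualShear (F : A) (i j : Fin 3) : A :=
  ∑ k, S.eps i k * S.hess F k j + ∑ k, S.eps j k * S.hess F k i

/-- The inner product of the gradients of two functions. -/
def dot (F G : A) : A := ∑ i, S.d i F * S.d i G

theorem d_X (i j : Fin 3) : S.d j (S.X i) = S.met i j := S.d_X' i j

theorem met_symm (i j : Fin 3) : S.met i j = S.met j i := by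
  simp only [met, eq_comm, mul_comm]

theorem sum_met_mul (i : Fin 3) (v : Fin 3 → A) :
    ∑ a, S.met i a * v a = v i - S.X i * ∑ a, S.X a * v a := by
  simp [met, sub_mul, Finset.sum_sub_distrib, Finset.mul_sum, mul_assoc]

theorem sum_met_d (b : Fin 3) (F : A) : ∑ j, S.met j b * S.d j F = S.d b F := by
  simp only [S.met_symm _ b, sum_met_mul, S.sum_X_d, mul_zero, sub_zero]

theorem sum_X_met (i : Fin 3) : ∑ a, S.X a * S.met a i = 0 := by
  have h := S.sum_met_mul i S.X
  rw [S.sum_X_sq, mul_one, sub_self] at h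
  simpa only [mul_comm, S.met_symm i] using h

theorem trace_met : ∑ i, S.met i i = 2 := by
  have h := S.sum_X_sq
  simp only [met, Fin.sum_univ_three, if_true] at h ⊢
  linear_combination -h

/-- Differentiate the tangency relation. -/
theorem sum_X_mul_d {v : Fin 3 → A} (hv : ∑ a, S.X a * v a = 0) (j : Fin 3) :
    ∑ a, S.X a * S.d j (v a) = -v j := by
  have h := congrArg (S.d j) hv
  rw [map_sum, map_zero] at h
  simp only [Derivation.leibniz, smul_eq_mul, Finset.sum_add_distrib, S.d_X,
    mul_comm (v _), S.met_symm _ j, sum_met_mul] at h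
  rw [hv] at h
  linear_combination h

theorem cov1_eq {v : Fin 3 → A} (hv : ∑ a, S.X a * v a = 0) (i j : Fin 3) :
    S.cov1 v i j = S.d j (v i) + S.X i * v j := by
  rw [cov1, sum_met_mul, S.sum_X_mul_d hv]; ring

theorem hess_eq (F : A) (i j : Fin 3) : S.hess F i j = S.d j (S.d i F) + S.X i * S.d j F :=
  S.cov1_eq (S.sum_X_d F) i j

theorem hess_symm (F : A) (i j : Fin 3) : S.hess F i j = S.hess F j i := by
  rw [hess_eq, hess_eq]
  linear_combination S.comm i j F

theorem lap_eq (F : A) : S.lap F = ∑ i, S.d i (S.d i F) := by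
  simp only [lap, hess_eq, Finset.sum_add_distrib, S.sum_X_d, add_zero]

theorem sum_X_hess (F : A) (j : Fin 3) : ∑ i, S.X i * S.hess F i j = 0 := by
  simp only [S.hess_symm F _ j, hess_eq, mul_add, Finset.sum_add_distrib, S.sum_X_d, zero_add]
  simp only [mul_left_comm _ (S.X j), ← Finset.mul_sum, S.sum_X_d, mul_zero]

theorem sum_d_X_mul (F : A) : ∑ i, S.d i (S.X i * F) = 2 * F := by
  simp only [Derivation.leibniz, smul_eq_mul, S.d_X, Finset.sum_add_distrib, ← Finset.mul_sum,
    S.sum_X_d, S.trace_met]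
  ring

/-- Commuting `d i` past both derivatives of the Laplacian by `comm`; the first-order terms cancel.
-/
theorem lap_d (F : A) (i : Fin 3) : S.lap (S.d i F) = S.d i (S.lap F) - 2 * (S.X i * S.lap F) := by
  have h1 : ∀ b, S.d b (S.d b (S.d i F)) = S.d i (S.d b (S.d b F)) + S.X b * S.d i (S.d b F)
      - S.X i * S.d b (S.d b F) + S.d b (S.X b * S.d i F) - S.d b (S.X i * S.d b F) := by
    intro b
    have e1 : S.d b (S.d i F) = S.d i (S.d b F) + S.X b * S.d i F - S.X i * S.d b F := by
      linear_combination S.comm i b F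
    rw [e1, map_sub, map_add]
    linear_combination S.comm i b (S.d b F)
  rw [lap_eq, Finset.sum_congr rfl fun b _ => h1 b]
  simp only [Finset.sum_sub_distrib, Finset.sum_add_distrib, S.sum_d_X_mul,
    S.sum_X_mul_d (S.sum_X_d F), ← Finset.mul_sum, ← map_sum, ← lap_eq]
  simp only [Derivation.leibniz, smul_eq_mul, S.d_X, Finset.sum_add_distrib,
    ← Finset.mul_sum, ← lap_eq, mul_comm (S.d _ F), S.sum_met_mul, S.sum_X_d]
  ring

theorem lap_mul (F G : A) : S.lap (F * G) = F * S.lap G + 2 * S.dot F G + G * S.lap F := by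
  simp only [lap_eq, dot, Derivation.leibniz, smul_eq_mul, map_add, Fin.sum_univ_three]
  ring

theorem lap_add (F G : A) : S.lap (F + G) = S.lap F + S.lap G := by
  simp only [lap_eq, map_add, Finset.sum_add_distrib]

theorem lap_sub (F G : A) : S.lap (F - G) = S.lap F - S.lap G := by
  simp only [lap_eq, map_sub, Finset.sum_sub_distrib]

theorem d_two_mul (i : Fin 3) (F : A) : S.d i (2 * F) = 2 * S.d i F := by
  rw [two_mul, map_add, two_mul]

/-! ### Divergences of the electric and magnetic shear. -/

theorem div2_eq {T : Fin 3 → Fin 3 → A} (hT : ∀ j, ∑ a, S.X a * T a j = 0) (i : Fin 3) :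
    S.div2 T i = ∑ j, S.d j (T i j) + S.X i * ∑ j, T j j := by
  have h1 : S.div2 T i = ∑ a, S.met i a * ∑ b, S.d b (T a b) := by
    rw [div2, Finset.sum_comm]
    refine Finset.sum_congr rfl fun a _ => ?_
    rw [Finset.sum_comm, Finset.mul_sum]
    refine Finset.sum_congr rfl fun b _ => ?_
    rw [← S.sum_met_d, Finset.mul_sum]
    simp only [mul_assoc]
  rw [h1, sum_met_mul]
  have h2 : ∑ a, S.X a * ∑ b, S.d b (T a b) = -∑ b, T b b := by
    simp only [Finset.mul_sum]
    rw [Finset.sum_comm, ← Finset.sum_neg_distrib]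
    exact Finset.sum_congr rfl fun b _ => S.sum_X_mul_d (hT b) b
  rw [h2]
  ring

theorem div2_add (T U : Fin 3 → Fin 3 → A) (i : Fin 3) :
    S.div2 (fun i j => T i j + U i j) i = S.div2 T i + S.div2 U i := by
  simp only [div2, map_add, mul_add, Finset.sum_add_distrib]

theorem div2_sub (T U : Fin 3 → Fin 3 → A) (i : Fin 3) :
    S.div2 (fun i j => T i j - U i j) i = S.div2 T i - S.div2 U i := by
  simp only [div2, map_sub, mul_sub, Finset.sum_sub_distrib]

theorem shear_symm (F : A) (i j : Fin 3) : S.shear F i j = S.shear F j i := by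
  rw [shear, shear, S.hess_symm, S.met_symm]

theorem sum_X_shear (F : A) (j : Fin 3) : ∑ i, S.X i * S.shear F i j = 0 := by
  simp only [shear, mul_sub, Finset.sum_sub_distrib, mul_left_comm _ (2 : A), ← mul_assoc (S.X _),
    ← Finset.mul_sum, ← Finset.sum_mul, S.sum_X_met, S.sum_X_hess]
  ring

theorem trace_shear (F : A) : ∑ i, S.shear F i i = 0 := by
  simp only [shear, Finset.sum_sub_distrib, ← Finset.mul_sum, ← Finset.sum_mul, S.trace_met]
  rw [lap]; ring

/-- The term `2 F` reflects the Ricci curvature of the unit sphere, and is the origin of the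
operator `D² (D² + 2)`. -/
theorem div2_shear (F : A) (i : Fin 3) : S.div2 (S.shear F) i = S.d i (S.lap F + 2 * F) := by
  rw [S.div2_eq (S.sum_X_shear F), S.trace_shear, map_add, d_two_mul]
  have h1 : ∑ j, S.d j (S.shear F i j) = 2 * S.lap (S.d i F) + 2 * ∑ j, S.d j (S.X i * S.d j F)
      - ∑ j, S.d j (S.met i j * S.lap F) := by
    simp only [shear, hess_eq, map_sub, S.d_two_mul, map_add, lap_eq, Finset.sum_sub_distrib,
      Finset.mul_sum, mul_add, Finset.sum_add_distrib]
  have h2 : ∑ j, S.d j (S.X i * S.d j F) = S.X i * S.lap F + S.d i F := by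
    simp only [Derivation.leibniz, smul_eq_mul, S.d_X, Finset.sum_add_distrib,
      ← Finset.mul_sum, ← lap_eq, mul_comm (S.d _ F), S.sum_met_mul, S.sum_X_d]
    ring
  have h3 : ∑ j, S.d j (S.met i j * S.lap F) = S.d i (S.lap F) - 2 * (S.X i * S.lap F) := by
    have e : ∀ j, S.met i j * S.lap F = (if i = j then S.lap F else 0) - S.X j * (S.X i * S.lap F) := by
      intro j; rw [met]; split_ifs <;> ring
    simp only [e, map_sub, Finset.sum_sub_distrib, S.sum_d_X_mul]
    simp [apply_ite]
  rw [h1, h2, h3, lap_d]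
  ring

theorem eps_self (i : Fin 3) : S.eps i i = 0 :=
  Matrix.det_zero_of_row_eq (i := 1) (j := 2) (by decide) rfl

theorem eps_zero_one : S.eps 0 1 = S.X 2 := by simp [eps, Matrix.det_fin_three]
theorem eps_one_two : S.eps 1 2 = S.X 0 := by simp [eps, Matrix.det_fin_three]
theorem eps_zero_two : S.eps 0 2 = -S.X 1 := by simp [eps, Matrix.det_fin_three]
theorem eps_one_zero : S.eps 1 0 = -S.X 2 := by simp [eps, Matrix.det_fin_three]
theorem eps_two_one : S.eps 2 1 = -S.X 0 := by simp [eps, Matrix.det_fin_three]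
theorem eps_two_zero : S.eps 2 0 = S.X 1 := by simp [eps, Matrix.det_fin_three]

/-- The dual `ε_{ik} v_k` of a one-form. -/
def dual (v : Fin 3 → A) (i : Fin 3) : A := ∑ k, S.eps i k * v k

theorem dual_zero (v : Fin 3 → A) : S.dual v 0 = S.X 2 * v 1 - S.X 1 * v 2 := by
  simp [dual, Fin.sum_univ_three, eps_self, eps_zero_one, eps_zero_two]; ring

theorem dual_one (v : Fin 3 → A) : S.dual v 1 = S.X 0 * v 2 - S.X 2 * v 0 := by
  simp [dual, Fin.sum_univ_three, eps_self, eps_one_zero, eps_one_two]; ring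

theorem dual_two (v : Fin 3 → A) : S.dual v 2 = S.X 1 * v 0 - S.X 0 * v 1 := by
  simp [dual, Fin.sum_univ_three, eps_self, eps_two_zero, eps_two_one]; ring

theorem sum_X_dual (v : Fin 3 → A) : ∑ i, S.X i * S.dual v i = 0 := by
  simp only [Fin.sum_univ_three, dual_zero, dual_one, dual_two]; ring

/-- On tangent vectors `dual` is a quarter turn, hence an isometry. -/
theorem sum_dual_mul (u v : Fin 3 → A) (hu : ∑ i, S.X i * u i = 0) :
    ∑ i, S.dual u i * S.dual v i = ∑ i, u i * v i := by
  have h := S.sum_X_sq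
  simp only [Fin.sum_univ_three, dual_zero, dual_one, dual_two] at h hu ⊢
  linear_combination (u 0 * v 0 + u 1 * v 1 + u 2 * v 2) * h
    - (S.X 0 * v 0 + S.X 1 * v 1 + S.X 2 * v 2) * hu

/-- Conjugating a symmetric form on a plane by a quarter turn gives its cofactor form, `(tr T) h -
T`. -/
theorem sum_dual_mul_mul_dual {T : Fin 3 → Fin 3 → A} (hT : ∀ j, ∑ a, S.X a * T a j = 0)
    (hs : ∀ i j, T i j = T j i) (u v : Fin 3 → A)
    (hu : ∑ i, S.X i * u i = 0) :
    ∑ i, S.dual u i * ∑ j, T i j * S.dual v j =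
      (∑ i, T i i) * (∑ i, u i * v i) - ∑ i, u i * ∑ j, T i j * v j := by
  have h := S.sum_X_sq
  have h0 := hT 0
  have h1 := hT 1
  have h2 := hT 2
  simp only [Fin.sum_univ_three, dual_zero, dual_one, dual_two, hs 1 0, hs 2 0, hs 2 1]
    at h hu h0 h1 h2 ⊢
  linear_combination
    ((T 0 0 + T 1 1 + T 2 2) * (u 0 * v 0 + u 1 * v 1 + u 2 * v 2)
      - (u 0 * (T 0 0 * v 0 + T 0 1 * v 1 + T 0 2 * v 2)
        + u 1 * (T 0 1 * v 0 + T 1 1 * v 1 + T 1 2 * v 2)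
        + u 2 * (T 0 2 * v 0 + T 1 2 * v 1 + T 2 2 * v 2))) * h
    - (u 0 * v 0 + u 1 * v 1 + u 2 * v 2) * (S.X 0 * h0 + S.X 1 * h1 + S.X 2 * h2)
    + (S.X 0 * u 0 + S.X 1 * u 1 + S.X 2 * u 2) * (v 0 * h0 + v 1 * h1 + v 2 * h2)
    + (S.X 0 * v 0 + S.X 1 * v 1 + S.X 2 * v 2) * (u 0 * h0 + u 1 * h1 + u 2 * h2)
    - (S.X 0 * v 0 + S.X 1 * v 1 + S.X 2 * v 2) * (T 0 0 + T 1 1 + T 2 2) * hu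

/-- The pure-trace part of the Hessian drops out of the symmetrized dual, and a quarter turn of one
slot of a symmetric traceless tensor in two dimensions is already symmetric. So the magnetic shear
is the rotated electric shear. -/
theorem dualShear_eq (F : A) (i j : Fin 3) :
    S.dualShear F i j = S.dual (fun k => S.shear F k j) i := by
  have h0 := S.sum_X_hess F 0
  have h1 := S.sum_X_hess F 1
  have h2 := S.sum_X_hess F 2
  have e10 := S.hess_symm F 1 0
  have e20 := S.hess_symm F 2 0
  have e21 := S.hess_symm F 2 1
  change S.dual (fun k => S.hess F k j) i + S.dual (fun k => S.hess F k i) j = _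
  fin_cases i <;> fin_cases j <;>
    simp [Fin.sum_univ_three, dual_zero, dual_one, dual_two, shear, met, lap, e10, e20, e21]
      at h0 h1 h2 ⊢
  · ring
  · linear_combination h2
  · linear_combination -h1
  · linear_combination -h2
  · ring
  · linear_combination h0
  · linear_combination h1
  · linear_combination -h0
  · ring

theorem sum_X_dualShear (F : A) (j : Fin 3) : ∑ i, S.X i * S.dualShear F i j = 0 := by
  simp only [dualShear_eq, sum_X_dual]

theorem dualShear_symm (F : A) (i j : Fin 3) : S.dualShear F i j = S.dualShear F j i :=
  add_comm _ _

theorem trace_dualShear (F : A) : ∑ i, S.dualShear F i i = 0 := by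
  simp only [dualShear_eq, Fin.sum_univ_three, dual_zero, dual_one, dual_two, S.shear_symm F 1 0,
    S.shear_symm F 2 0, S.shear_symm F 2 1]
  ring

/-- The volume form is parallel, so the divergence commutes with the rotation of the free slot. -/
theorem div2_dualShear (F : A) (i : Fin 3) :
    S.div2 (S.dualShear F) i = S.dual (fun k => S.d k (S.lap F + 2 * F)) i := by
  have hX := fun k => S.sum_X_shear F k
  have h : ∀ k, S.d k (S.lap F + 2 * F) = ∑ j, S.d j (S.shear F k j) := by
    intro k
    rw [← div2_shear, S.div2_eq (S.sum_X_shear F), S.trace_shear, mul_zero, add_zero]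
  have h0 := hX 0
  have h1 := hX 1
  have h2 := hX 2
  rw [S.div2_eq (S.sum_X_dualShear F), S.trace_dualShear, mul_zero, add_zero]
  simp only [h, dualShear_eq]
  fin_cases i <;>
    simp [Fin.sum_univ_three, dual_zero, dual_one, dual_two, Derivation.leibniz, d_X, met,
      S.shear_symm F 1 0, S.shear_symm F 2 0, S.shear_symm F 2 1] at h0 h1 h2 ⊢
  · linear_combination S.X 1 * h2 - S.X 2 * h1
  · linear_combination S.X 2 * h0 - S.X 0 * h2
  · linear_combination S.X 0 * h1 - S.X 1 * h0

theorem cov1_add (v w : Fin 3 → A) (i j : Fin 3) :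
    S.cov1 (fun k => v k + w k) i j = S.cov1 v i j + S.cov1 w i j := by
  simp only [cov1, map_add, mul_add, Finset.sum_add_distrib]

theorem cov1_dual_d (F : A) (i k : Fin 3) :
    S.cov1 (S.dual fun j => S.d j F) i k = S.dual (fun j => S.hess F j k) i := by
  have h := S.sum_X_sq
  have hF := S.sum_X_d F
  rw [S.cov1_eq (S.sum_X_dual _)]
  simp only [hess_eq]
  fin_cases i <;> fin_cases k <;>
    simp [Fin.sum_univ_three, dual_zero, dual_one, dual_two, Derivation.leibniz, d_X, met]
      at h hF ⊢
  · ring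
  · linear_combination S.d 2 F * h - S.X 2 * hF
  · linear_combination -S.d 1 F * h + S.X 1 * hF
  · linear_combination -S.d 2 F * h + S.X 2 * hF
  · ring
  · linear_combination S.d 0 F * h - S.X 0 * hF
  · linear_combination S.d 1 F * h - S.X 1 * hF
  · linear_combination -S.d 0 F * h + S.X 0 * hF
  · ring

/-- An antisymmetric tensor contracted with a symmetric Hessian. Hence the magnetic potential does
not contribute to the double divergence of the shear. -/
theorem sum_cov1_dual_d (F : A) : ∑ i, S.cov1 (S.dual fun j => S.d j F) i i = 0 := by
  simp only [cov1_dual_d, Fin.sum_univ_three, dual_zero, dual_one, dual_two, S.hess_symm F 1 0,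
    S.hess_symm F 2 0, S.hess_symm F 2 1]
  ring

/-! ### Integration by parts. -/

theorem I_sum_d {W : Fin 3 → A} (hW : ∑ i, S.X i * W i = 0) : S.I (∑ i, S.d i (W i)) = 0 := by
  rw [map_sum]
  simp only [I_d, ← Finset.mul_sum, ← map_sum, hW, map_zero, mul_zero]

theorem dot_comm (F G : A) : S.dot F G = S.dot G F := by
  simp only [dot, mul_comm]

theorem I_mul_lap (F G : A) : S.I (F * S.lap G) = -S.I (S.dot F G) := by
  have h := S.I_sum_d (W := fun i => F * S.d i G) (by
    simp only [mul_left_comm _ F, ← Finset.mul_sum, S.sum_X_d, mul_zero])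
  have e : ∑ i, S.d i (F * S.d i G) = F * S.lap G + S.dot F G := by
    simp only [lap_eq, dot, Derivation.leibniz, smul_eq_mul, Finset.sum_add_distrib,
      Finset.mul_sum, mul_comm]
  rw [e, map_add] at h
  linarith

theorem I_mul_lap_comm (F G : A) : S.I (F * S.lap G) = S.I (G * S.lap F) := by
  rw [I_mul_lap, I_mul_lap, dot_comm]

theorem dot_mul (H F G : A) : S.dot H (F * G) = F * S.dot H G + G * S.dot H F := by
  simp only [dot, Derivation.leibniz, smul_eq_mul, Fin.sum_univ_three]
  ring

/-- The divergence theorem for `F T(Z)`. The hypothesis `hd` holds when `Z` is Killing, and for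
traceless `T` when `Z` is conformal Killing; both cases are used. -/
theorem I_parts {T : Fin 3 → Fin 3 → A} (hT : ∀ j, ∑ a, S.X a * T a j = 0)
    (hs : ∀ i j, T i j = T j i) {Z : Fin 3 → A} (hZ : ∑ i, S.X i * Z i = 0)
    (hd : ∑ i, ∑ j, T i j * S.d j (Z i) = 0) (F : A) :
    S.I (∑ i, Z i * ∑ j, T i j * S.d j F) = -S.I (F * ∑ i, Z i * S.div2 T i) := by
  have h := S.I_sum_d (W := fun j => F * ∑ i, Z i * T i j) (by
    have h0 := hT 0
    have h1 := hT 1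
    have h2 := hT 2
    simp only [Fin.sum_univ_three, hs 1 0, hs 2 0, hs 2 1] at h0 h1 h2 ⊢
    linear_combination F * (Z 0 * h0 + Z 1 * h1 + Z 2 * h2))
  have e : ∑ j, S.d j (F * ∑ i, Z i * T i j) =
      ∑ i, Z i * ∑ j, T i j * S.d j F + F * ∑ i, Z i * S.div2 T i := by
    simp only [S.div2_eq hT]
    simp only [Fin.sum_univ_three] at hd hZ ⊢
    simp only [Derivation.leibniz, smul_eq_mul, map_add]
    linear_combination F * hd - F * (T 0 0 + T 1 1 + T 2 2) * hZ
  rw [e, map_add] at h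
  linarith

/-! ### Dipole functions and their Killing and conformal Killing fields. -/

/-- `n` is the restriction of a linear function with coefficients `α`. -/
structure IsLinear (n : A) (α : Fin 3 → A) : Prop where
  d_coeff : ∀ i j, S.d j (α i) = 0
  eq : n = ∑ i, S.X i * α i

namespace IsLinear

variable {S} {n : A} {α : Fin 3 → A} (hn : S.IsLinear n α)
include hn

theorem d_eq (i : Fin 3) : S.d i n = α i - S.X i * n := by
  rw [hn.eq, map_sum]
  simp only [Derivation.leibniz, smul_eq_mul, hn.d_coeff, mul_zero, zero_add, S.d_X,
    mul_comm (α _), S.met_symm _ i, S.sum_met_mul]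

theorem hess_eq (i j : Fin 3) : S.hess n i j = -(S.met i j * n) := by
  rw [S.hess_eq, hn.d_eq, map_sub, hn.d_coeff, Derivation.leibniz, S.d_X, smul_eq_mul, smul_eq_mul]
  ring

theorem lap_eq : S.lap n = -(2 * n) := by
  simp only [lap, hn.hess_eq, Finset.sum_neg_distrib, ← Finset.sum_mul, S.trace_met]

theorem I_dot (G : A) : S.I (S.dot n G) = 2 * S.I (n * G) := by
  have h := S.I_mul_lap G n
  rw [hn.lap_eq, S.dot_comm, show G * -(2 * n) = -((2 : ℝ) • (n * G)) by
    rw [ofNat_smul_eq_nsmul, nsmul_eq_mul]; push_cast; ring, map_neg, map_smul, smul_eq_mul] at h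
  linarith

/-- By tangency of `dQ`, `dot n Q` is the derivative of `Q` along the constant vector `α`, so
`lap_d` applies. -/
theorem lap_dot (Q : A) : S.lap (S.dot n Q) = S.dot n (S.lap Q) - 2 * (n * S.lap Q) := by
  have h2 : ∀ F, S.dot n F = ∑ i, α i * S.d i F := by
    intro F
    simp only [dot, hn.d_eq, sub_mul, Finset.sum_sub_distrib, mul_right_comm _ n, ← Finset.sum_mul,
      S.sum_X_d, zero_mul, sub_zero]
  have h3 : ∀ i F, S.lap (α i * F) = α i * S.lap F := by
    intro i F
    simp only [S.lap_eq, Derivation.leibniz, smul_eq_mul, hn.d_coeff, mul_zero, add_zero,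
      Finset.mul_sum]
  rw [h2, h2, hn.eq]
  simp only [Fin.sum_univ_three, S.lap_add, h3, S.lap_d]
  ring

theorem lap_mul (Q : A) : S.lap (n * Q) = n * S.lap Q + 2 * S.dot n Q - 2 * (n * Q) := by
  rw [S.lap_mul, hn.lap_eq]; ring

/-- The Hessian of `n` is a multiple of the metric, so `∇n` is conformal Killing and traceless
tensors annihilate its derivative. -/
theorem sum_mul_d_d {T : Fin 3 → Fin 3 → A} (hT : ∀ j, ∑ a, S.X a * T a j = 0)
    (htr : ∑ i, T i i = 0) : ∑ i, ∑ j, T i j * S.d j (S.d i n) = 0 := by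
  have e : ∀ i j, S.d j (S.d i n) = -(S.met i j * n) - S.X i * S.d j n := by
    intro i j
    rw [← hn.hess_eq, S.hess_eq]; ring
  have h0 := hT 0
  have h1 := hT 1
  have h2 := hT 2
  simp only [e, Fin.sum_univ_three, met] at htr h0 h1 h2 ⊢
  simp
  linear_combination -n * htr + (n * S.X 0 - S.d 0 n) * h0 + (n * S.X 1 - S.d 1 n) * h1
    + (n * S.X 2 - S.d 2 n) * h2

/-- The rotation field `ε_{ik} n_{||k}` in terms of the coefficients of `n`. -/
theorem dual_d_eq : S.dual (fun k => S.d k n) = S.dual α := by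
  funext i
  simp only [hn.d_eq]
  fin_cases i <;> simp [dual_zero, dual_one, dual_two] <;> ring

/-- The rotation field is Killing: its derivative is antisymmetric on tangent vectors. -/
theorem sum_mul_d_dual {T : Fin 3 → Fin 3 → A} (hT : ∀ j, ∑ a, S.X a * T a j = 0)
    (hs : ∀ i j, T i j = T j i) :
    ∑ i, ∑ j, T i j * S.d j (S.dual (fun k => S.d k n) i) = 0 := by
  have hTd : ∀ a m, ∑ j, T a j * S.d j (S.X m) = T a m := by
    intro a m
    simp only [S.d_X, mul_comm (T a _), S.sum_met_mul]
    simp only [hs a, hT, mul_zero, sub_zero]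
  rw [hn.dual_d_eq]
  simp only [Fin.sum_univ_three] at hTd ⊢
  simp only [dual_zero, dual_one, dual_two, map_sub, Derivation.leibniz, smul_eq_mul, hn.d_coeff]
  linear_combination α 1 * hTd 0 2 + α 2 * hTd 1 0 + α 0 * hTd 2 1 - α 0 * hTd 1 2
    - α 1 * hTd 2 0 - α 2 * hTd 0 1 + α 1 * hs 0 2 + α 2 * hs 1 0 + α 0 * hs 2 1

theorem I_rot (G : A) : S.I (∑ i, S.dual (fun k => S.d k n) i * S.d i G) = 0 := by
  rw [hn.dual_d_eq]
  have h := S.I_sum_d (W := fun i => G * S.dual α i) (by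
    simp only [mul_left_comm _ G, ← Finset.mul_sum, S.sum_X_dual, mul_zero])
  have e : ∑ i, S.d i (G * S.dual α i) = ∑ i, S.dual α i * S.d i G := by
    simp only [Fin.sum_univ_three, dual_zero, dual_one, dual_two, map_sub, Derivation.leibniz,
      smul_eq_mul, hn.d_coeff, S.d_X, S.met_symm 1 0, S.met_symm 2 0, S.met_symm 2 1]
    ring
  rwa [e] at h

theorem I_rot_parts {T : Fin 3 → Fin 3 → A} (hT : ∀ j, ∑ a, S.X a * T a j = 0)
    (hs : ∀ i j, T i j = T j i) (F : A) :
    S.I (∑ i, S.dual (fun k => S.d k n) i * ∑ j, T i j * S.d j F) =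
      -S.I (F * ∑ i, S.dual (fun k => S.d k n) i * S.div2 T i) :=
  S.I_parts hT hs (S.sum_X_dual _) (hn.sum_mul_d_dual hT hs) F

theorem I_d_parts {T : Fin 3 → Fin 3 → A} (hT : ∀ j, ∑ a, S.X a * T a j = 0)
    (hs : ∀ i j, T i j = T j i) (htr : ∑ i, T i i = 0) (F : A) :
    S.I (∑ i, S.d i n * ∑ j, T i j * S.d j F) = -S.I (F * ∑ i, S.d i n * S.div2 T i) :=
  S.I_parts hT hs (S.sum_X_d n) (hn.sum_mul_d_d hT htr) F

end IsLinear

/-! ### Variation of the shear part of the angular momentum. -/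

/-- The antisymmetrized derivative of a one-form `P_{||i} + ε_{ik} Q_{||k}`, contracted with a
rotation field and a gradient. -/
theorem sum_dual_curl (n f P Q : A) :
    ∑ i, S.dual (fun k => S.d k n) i * (∑ k, S.d k f *
        S.cov1 (fun i => S.d i P + S.dual (fun j => S.d j Q) i) i k
      - ∑ k, S.d k f * S.cov1 (fun i => S.d i P + S.dual (fun j => S.d j Q) i) k i) =
      S.dot n f * S.lap Q := by
  have hH := fun i k => S.hess_symm P i k
  have h1 : ∀ k, ∑ i, S.dual (fun k => S.d k n) i * S.dual (fun j => S.hess Q j k) i =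
      ∑ i, S.d i n * S.hess Q i k := fun k => S.sum_dual_mul _ _ (S.sum_X_d n)
  have h2 := S.sum_dual_mul_mul_dual (S.sum_X_hess Q) (S.hess_symm Q) (fun k => S.d k f)
    (fun k => S.d k n) (S.sum_X_d f)
  have h3 : ∀ i, ∑ k, S.d k f * S.dual (fun j => S.hess Q j i) k =
      -∑ k, S.dual (fun k => S.d k f) k * S.hess Q k i := by
    intro i
    simp only [Fin.sum_univ_three, dual_zero, dual_one, dual_two]
    ring
  simp only [cov1_add, cov1_dual_d, mul_add, Finset.sum_add_distrib, h3]
  have e10 := hH 1 0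
  have e20 := hH 2 0
  have e21 := hH 2 1
  have h10 := h1 0
  have h11 := h1 1
  have h12 := h1 2
  change ∑ i, S.dual (fun k => S.d k n) i * (∑ k, S.d k f * S.hess P i k
    + ∑ k, S.d k f * S.dual (fun j => S.hess Q j k) i - (∑ k, S.d k f * S.hess P k i
    + -∑ k, S.dual (fun k => S.d k f) k * S.hess Q k i)) = _
  have q10 := S.hess_symm Q 1 0
  have q20 := S.hess_symm Q 2 0
  have q21 := S.hess_symm Q 2 1
  rw [dot, lap]
  simp only [Fin.sum_univ_three, e10, e20, e21, q10, q20, q21] at h10 h11 h12 h2 ⊢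
  linear_combination S.d 0 f * h10 + S.d 1 f * h11 + S.d 2 f * h12 + h2

/-- The change of the shear part of the angular momentum under a supertranslation. -/
theorem I_shear_variation {n : A} {α : Fin 3 → A} (hn : S.IsLinear n α) (f c b : A)
    {χ : Fin 3 → Fin 3 → A} (hχ : χ = fun i j => S.shear c i j + S.dualShear b i j) :
    S.I (∑ i, S.dual (fun k => S.d k n) i *
      (3 * (∑ k, S.d k f * S.cov1 (S.div2 χ) i k - ∑ k, S.d k f * S.cov1 (S.div2 χ) k i)
        + ∑ j, (χ i j - S.shear f i j) * (S.div2 χ j - S.d j (S.lap f + 2 * f))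
        - ∑ j, χ i j * S.div2 χ j)) = -S.I (f * S.dot n (S.lap (S.lap b + 2 * b))) := by
  set P := S.lap c + 2 * c with hP
  set Q := S.lap b + 2 * b with hQ
  set F := S.lap f + 2 * f with hF
  set Y := S.dual (fun k => S.d k n) with hY
  set V := S.div2 χ with hV
  have hVeq : V = fun i => S.d i P + S.dual (fun j => S.d j Q) i := by
    funext i
    rw [hV, hχ, div2_add, div2_shear, div2_dualShear]
  have hT : ∀ j, ∑ a, S.X a * χ a j = 0 := by
    intro j
    simp only [hχ, mul_add, Finset.sum_add_distrib, sum_X_shear, sum_X_dualShear, add_zero]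
  have hs : ∀ i j, χ i j = χ j i := by
    intro i j
    simp only [hχ]
    rw [S.shear_symm, S.dualShear_symm]
  have curl := S.sum_dual_curl n f P Q
  rw [← hVeq, ← hY] at curl
  have hYV : ∑ i, Y i * V i = ∑ i, Y i * S.d i P + S.dot n Q := by
    simp only [hVeq, mul_add, Finset.sum_add_distrib]
    rw [hY, S.sum_dual_mul _ _ (S.sum_X_d n), dot]
  have hYF : ∑ i, Y i * S.div2 (S.shear f) i = ∑ i, Y i * S.d i F := by
    simp only [div2_shear, hF]
  have tA := hn.I_rot_parts hT hs F
  have tB := hn.I_rot_parts (S.sum_X_shear f) (S.shear_symm f) P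
  have tC := hn.I_rot_parts (S.sum_X_shear f) (S.shear_symm f) F
  have tM := hn.I_d_parts (S.sum_X_shear f) (S.shear_symm f) (S.trace_shear f) Q
  rw [← hY, ← hV, hYV] at tA
  rw [← hY, hYF] at tB tC
  have hnF : ∑ i, S.d i n * S.div2 (S.shear f) i = S.dot n F := by
    simp only [div2_shear, hF, dot]
  rw [hnF] at tM
  -- The terms pairing `P` with `F`, and `F` with itself, are derivatives of `P F` and `F²` along
  -- the divergence-free field `Y`.
  have rPF := hn.I_rot (P * F)
  have rFF := hn.I_rot (F * F)
  rw [← hY] at rPF rFF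
  have lei : ∀ G H, ∑ i, Y i * S.d i (G * H) = G * ∑ i, Y i * S.d i H + H * ∑ i, Y i * S.d i G := by
    intro G H
    simp only [Derivation.leibniz, smul_eq_mul, Fin.sum_univ_three]
    ring
  rw [lei, map_add] at rPF rFF
  -- Rotating both slots of a traceless tensor reverses its sign. This replaces `Y` and `*dQ` by
  -- `∇n` and `dQ`, after which `tM` integrates by parts.
  have mag := S.sum_dual_mul_mul_dual (S.sum_X_shear f) (S.shear_symm f) (fun k => S.d k n)
    (fun k => S.d k Q) (S.sum_X_d n)
  rw [S.trace_shear, zero_mul, zero_sub, ← hY] at mag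
  have dQF := hn.I_dot (Q * F)
  rw [S.dot_mul, map_add] at dQF
  have dfB := hn.I_dot (f * S.lap Q)
  rw [S.dot_mul, map_add] at dfB
  -- The `Q`-terms from the shear reduce to `2 ∫ F (∇n·∇Q - nQ)`. Self-adjointness of `D²` moves it
  -- off `f`, giving `2 ∫ f (∇n·∇D²Q - 3 n D²Q)`; the curl term contributes `6 ∫ n f D²Q - 3 ∫ f
  -- ∇n·∇D²Q`.
  have adj := S.I_mul_lap_comm (S.dot n Q - n * Q) f
  rw [S.lap_sub, hn.lap_dot, hn.lap_mul] at adj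
  have split : ∑ i, Y i * (3 * (∑ k, S.d k f * S.cov1 V i k - ∑ k, S.d k f * S.cov1 V k i)
        + ∑ j, (χ i j - S.shear f i j) * (V j - S.d j F) - ∑ j, χ i j * V j) =
      (S.lap Q * S.dot n f + S.lap Q * S.dot n f + S.lap Q * S.dot n f)
      - ∑ i, Y i * ∑ j, χ i j * S.d j F
      - ∑ i, Y i * ∑ j, S.shear f i j * S.d j P
      + ∑ i, S.d i n * ∑ j, S.shear f i j * S.d j Q
      + ∑ i, Y i * ∑ j, S.shear f i j * S.d j F := by
    have e : ∀ i, ∑ j, (χ i j - S.shear f i j) * (V j - S.d j F) = ∑ j, χ i j * V j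
        - ∑ j, χ i j * S.d j F - ∑ j, S.shear f i j * S.d j P
        - ∑ j, S.shear f i j * S.dual (fun j => S.d j Q) j + ∑ j, S.shear f i j * S.d j F := by
      intro i
      simp only [hVeq, Fin.sum_univ_three]
      ring
    simp only [e]
    rw [show S.lap Q * S.dot n f = S.dot n f * S.lap Q from mul_comm _ _, ← curl,
      ← neg_eq_iff_eq_neg.mpr mag]
    simp only [← Finset.sum_add_distrib, ← Finset.sum_sub_distrib, ← Finset.sum_neg_distrib]
    refine Finset.sum_congr rfl fun i _ => ?_
    simp only [Finset.sum_add_distrib, Finset.sum_sub_distrib]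
    ring
  rw [split]
  -- Integer multiples are written as repeated sums, so that additivity of `I` reduces everything to
  -- the same elementary integrals.
  have expand : f * (S.dot n (S.lap Q) - 2 * (n * S.lap Q) - (n * S.lap Q + 2 * S.dot n Q
      - 2 * (n * Q))) = f * S.dot n (S.lap Q) - (n * (f * S.lap Q) + n * (f * S.lap Q)
      + n * (f * S.lap Q)) - (f * S.dot n Q + f * S.dot n Q) + (n * (Q * f) + n * (Q * f)) := by ring
  have expand2 : (S.dot n Q - n * Q) * S.lap f = F * S.dot n Q - n * (Q * F)
      - (f * S.dot n Q + f * S.dot n Q) + (n * (Q * f) + n * (Q * f)) := by rw [hF]; ring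
  rw [expand, expand2] at adj
  simp only [map_add, map_sub, mul_add] at *
  linarith

/-! ### The kernel of `D² (D² + 2)`, algebraic part. -/

/-- A function in the kernel of `D² (D² + 2)` has vanishing shear in the mean. -/
theorem I_shear_sq {g : A} (hg : S.lap (S.lap g + 2 * g) = 0) :
    S.I (∑ i, ∑ j, S.shear g i j * S.shear g i j) = 0 := by
  set F := S.lap g + 2 * g with hF
  -- The divergence of the shear contracted with `∇g` integrates to zero, so `∫ shear : hess = -∫
  -- ∇g·∇F = ∫ g D²F = 0`. By tracelessness `|shear|²` is twice `shear : hess`.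
  have h := S.I_sum_d (W := fun j => ∑ i, S.d i g * S.shear g i j) (by
    have h0 := S.sum_X_shear g 0
    have h1 := S.sum_X_shear g 1
    have h2 := S.sum_X_shear g 2
    simp only [Fin.sum_univ_three, S.shear_symm g 1 0, S.shear_symm g 2 0, S.shear_symm g 2 1]
      at h0 h1 h2 ⊢
    linear_combination S.d 0 g * h0 + S.d 1 g * h1 + S.d 2 g * h2)
  have hdiv : ∀ i, ∑ j, S.d j (S.shear g i j) = S.d i F := by
    intro i
    rw [hF, ← div2_shear, S.div2_eq (S.sum_X_shear g), S.trace_shear, mul_zero, add_zero]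
  have e : ∑ j, S.d j (∑ i, S.d i g * S.shear g i j) =
      ∑ i, ∑ j, S.shear g i j * S.hess g i j + S.dot g F := by
    have h0 := S.sum_X_shear g 0
    have h1 := S.sum_X_shear g 1
    have h2 := S.sum_X_shear g 2
    simp only [dot, ← hdiv, S.hess_eq]
    simp only [Fin.sum_univ_three, map_add, Derivation.leibniz, smul_eq_mul] at h0 h1 h2 ⊢
    linear_combination -S.d 0 g * h0 - S.d 1 g * h1 - S.d 2 g * h2
  have h3 : S.I (S.dot g F) = 0 := by
    have := S.I_mul_lap g F
    rw [hg, mul_zero, map_zero] at this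
    linarith
  have h4 : ∑ i, ∑ j, S.shear g i j * S.shear g i j =
      ∑ i, ∑ j, S.shear g i j * S.hess g i j + ∑ i, ∑ j, S.shear g i j * S.hess g i j := by
    have htr := S.trace_shear g
    have h0 := S.sum_X_shear g 0
    have h1 := S.sum_X_shear g 1
    have h2 := S.sum_X_shear g 2
    have e : ∀ i j, S.shear g i j * S.shear g i j = S.shear g i j * S.hess g i j
        + S.shear g i j * S.hess g i j - S.lap g * (S.shear g i j * S.met i j) := by
      intro i j
      nth_rewrite 2 [shear]
      ring
    simp only [e]
    have z : ∑ i, ∑ j, S.shear g i j * S.met i j = 0 := by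
      simp only [Fin.sum_univ_three, met] at htr h0 h1 h2 ⊢
      simp
      linear_combination htr - S.X 0 * h0 - S.X 1 * h1 - S.X 2 * h2
    simp only [Finset.sum_add_distrib, Finset.sum_sub_distrib, ← Finset.mul_sum, z, mul_zero,
      sub_zero]
  rw [e, map_add, h3, add_zero] at h
  rw [h4, map_add, h, add_zero]

/-- If the shear and the gradient of `D² g + 2 g` vanish, the gradient of `g` is that of a linear
function up to the coordinate part. -/
theorem d_of_shear_eq_zero {g k : A} (hk : ∀ i, S.d i k = 0) (hg : S.lap g + 2 * g = 2 * k)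
    (h : ∀ i j, S.shear g i j = 0) (i j : Fin 3) :
    2 * S.d j (S.d i g + S.X i * (g - k)) = 0 := by
  have h1 := h i j
  rw [shear, show S.lap g = 2 * (k - g) by linear_combination hg, S.hess_eq] at h1
  rw [map_add, Derivation.leibniz, map_sub, hk, S.d_X]
  simp only [smul_eq_mul]
  linear_combination h1

end SphereCalculus

/-! ### Smooth functions on the sphere as a model of the calculus. -/

/-- The ring of smooth functions on the sphere. -/
abbrev SmoothFn := ContMDiffMap (𝓡 2) 𝓘(ℝ, ℝ) S2 ℝ ∞

theorem SmoothFn.smooth (F : SmoothFn) : Smooth F := F.contMDiff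

/-- Evaluation at a point. -/
def ev (x : S2) : SmoothFn →ₐ[ℝ] ℝ := (Pi.evalAlgHom ℝ _ x).comp ContMDiffMap.coeFnAlgHom

theorem ev_apply (x : S2) (F : SmoothFn) : ev x F = F x := rfl

theorem ext_ev {F G : SmoothFn} (h : ∀ x, ev x F = ev x G) : F = G :=
  ContMDiffMap.ext h

/-- The components of the tangential gradient as derivations. -/
def pdDerivation (i : Fin 3) : Derivation ℝ SmoothFn SmoothFn :=
  Derivation.mk'
    { toFun := fun F => ⟨pd F i, smooth_pd F.smooth i⟩
      map_add' := fun F G => ContMDiffMap.ext fun x => pd_add F.smooth G.smooth i x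
      map_smul' := fun r F => ContMDiffMap.ext fun x => by
        have h := pd_mul (smooth_of_contDiffAt (G := fun _ => r) fun _ => contDiffAt_const)
          F.smooth i x
        rw [pd_const, mul_zero, add_zero] at h
        exact h }
    fun F G => ContMDiffMap.ext fun x => pd_mul F.smooth G.smooth i x

theorem ev_pdDerivation (x : S2) (i : Fin 3) (F : SmoothFn) :
    ev x (pdDerivation i F) = pd F i x := rfl

/-- Integration over the sphere as a linear functional. -/
def sintLinear : SmoothFn →ₗ[ℝ] ℝ where
  toFun F := sint F
  map_add' F G := integral_add F.smooth.integrable G.smooth.integrable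
  map_smul' r _ := integral_const_mul r _

/-- The coordinate functions. -/
def coordFn (i : Fin 3) : SmoothFn := ⟨fun x => (x : E3) i, smooth_coord i⟩

theorem ev_coordFn (x : S2) (i : Fin 3) : ev x (coordFn i) = (x : E3) i := rfl

/-- Calculus on the unit sphere. -/
def sph : SphereCalculus SmoothFn where
  X := coordFn
  d := pdDerivation
  I := sintLinear
  sum_X_sq := ext_ev fun x => by
    simp only [map_sum, map_mul, map_one, ev_coordFn, sum_coe_sq]
  d_X' i j := ext_ev fun x => by
    simp only [map_sub, map_mul, ev_coordFn]
    rw [apply_ite (ev x), map_one, map_zero]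
    exact pd_coord i j x
  sum_X_d F := ext_ev fun x => by
    simp only [map_sum, map_mul, map_zero, ev_coordFn, ev_pdDerivation]
    exact sum_coord_mul_pd F.smooth x
  comm i j F := ext_ev fun x => by
    simp only [map_sub, map_mul, ev_coordFn, ev_pdDerivation]
    exact pd_pd_sub F.smooth i j x
  I_d i F := sint_pd F.smooth i


theorem ev_X (x : S2) (i : Fin 3) : ev x (sph.X i) = (x : E3) i := rfl

theorem ev_d (x : S2) (i : Fin 3) (F : SmoothFn) : ev x (sph.d i F) = pd F i x := rfl

theorem I_eq (F : SmoothFn) : sph.I F = sint F := rfl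

theorem ev_met (x : S2) (i j : Fin 3) : ev x (sph.met i j) = met x i j := by
  rw [SphereCalculus.met, met, map_sub, map_mul, ev_X, ev_X, apply_ite (ev x), map_one, map_zero]

theorem ev_eps (x : S2) (i j : Fin 3) : ev x (sph.eps i j) = eps x i j := by
  rw [SphereCalculus.eps, eps, AlgHom.map_det]
  congr 1
  ext a b
  fin_cases a <;> simp [Pi.single_apply, ev_X, apply_ite (ev x)]

theorem ev_cov1 (x : S2) (v : Fin 3 → SmoothFn) (i j : Fin 3) :
    ev x (sph.cov1 v i j) = cov1 (fun y a => ev y (v a)) x i j := by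
  simp only [SphereCalculus.cov1, cov1, map_sum, map_mul, ev_met, ev_d]
  rfl

theorem ev_hess (x : S2) (F : SmoothFn) (i j : Fin 3) : ev x (sph.hess F i j) = hess F x i j :=
  ev_cov1 x _ i j

theorem ev_lap (x : S2) (F : SmoothFn) : ev x (sph.lap F) = lap F x := by
  simp only [SphereCalculus.lap, lap, map_sum, ev_hess]

theorem ev_div2 (x : S2) (T : Fin 3 → Fin 3 → SmoothFn) (i : Fin 3) :
    ev x (sph.div2 T i) = div2 (fun y a b => ev y (T a b)) x i := by
  simp only [SphereCalculus.div2, div2, cov2, map_sum, map_mul, ev_met, ev_d]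
  rfl

theorem ev_lapLap (x : S2) (F : SmoothFn) : ev x (sph.lap (sph.lap F + 2 * F)) = lapLap F x := by
  rw [ev_lap, lapLap]
  congr 1
  funext y
  rw [← ev_apply y (sph.lap F + 2 * F), map_add, map_mul, map_ofNat, ev_lap, ev_apply]

theorem ev_divdiv (x : S2) (T : Fin 3 → Fin 3 → SmoothFn) :
    ev x (∑ i, sph.cov1 (sph.div2 T) i i) = divdiv (fun y a b => ev y (T a b)) x := by
  simp only [divdiv, map_sum, ev_cov1, ev_div2]

theorem ev_dual_d (x : S2) (F : SmoothFn) (i : Fin 3) :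
    ev x (sph.dual (fun k => sph.d k F) i) = ∑ k, eps x i k * grad F x k := by
  simp only [SphereCalculus.dual, map_sum, map_mul, ev_eps, ev_d]
  rfl

/-- A dipole function is a linear function in the ring of smooth functions. -/
theorem IsDipole.exists_isLinear {n : S2 → ℝ} (hn : IsDipole n) :
    ∃ (nA : SmoothFn) (α : Fin 3 → SmoothFn), sph.IsLinear nA α ∧ ∀ x, nA x = n x := by
  obtain ⟨a, ha⟩ := hn
  refine ⟨∑ i, sph.X i * algebraMap ℝ SmoothFn (a i), fun i => algebraMap ℝ SmoothFn (a i),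
    ⟨fun i j => (sph.d j).map_algebraMap (a i), rfl⟩, fun x => ?_⟩
  rw [← ev_apply, ha]
  simp only [map_sum, map_mul, AlgHom.commutes, ev_X, PiLp.inner_apply]
  simp

/-! ### Uniqueness and identification of the electric potential. -/

theorem eq_zero_of_I_sq {ι : Type*} (s : Finset ι) (F : ι → SmoothFn)
    (h : sph.I (∑ i ∈ s, F i * F i) = 0) : ∀ i ∈ s, F i = 0 := by
  have h0 : (0 : S2 → ℝ) ≤ (∑ i ∈ s, F i * F i : SmoothFn) := fun x => by
    rw [← ev_apply, map_sum]
    exact Finset.sum_nonneg fun i _ => by rw [map_mul]; exact mul_self_nonneg _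
  have h1 := (integral_eq_zero_iff_of_nonneg h0 (SmoothFn.smooth _).integrable).mp h
  have h2 := (Continuous.ae_eq_iff_eq _ (SmoothFn.smooth _).continuous continuous_zero).mp h1
  intro i hi
  refine ext_ev fun x => ?_
  have h3 := congrFun h2 x
  rw [← ev_apply, map_sum, Pi.zero_apply, Finset.sum_eq_zero_iff_of_nonneg
    fun i _ => by rw [map_mul]; exact mul_self_nonneg _] at h3
  have := h3 i hi
  rw [map_mul, mul_self_eq_zero] at this
  rw [this, map_zero]

theorem exists_eq_algebraMap {F : SmoothFn} (h : ∀ i, sph.d i F = 0) :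
    ∃ k, F = algebraMap ℝ SmoothFn k := by
  obtain ⟨k, hk⟩ := constant_of_pd_eq_zero F.smooth fun i x => by rw [← ev_d, h, map_zero]
  exact ⟨k, ext_ev fun x => by rw [AlgHom.commutes]; exact hk x⟩

/-- The kernel of `D² (D² + 2)` consists of functions with `l = 0, 1` parts only. -/
theorem eq_zero_of_lapLap {g : SmoothFn} (hg : sph.lap (sph.lap g + 2 * g) = 0)
    (h0 : NoMonopolePart g) (h1 : NoDipolePart g) : g = 0 := by
  have hs := sph.I_shear_sq hg
  rw [← Finset.sum_product' (f := fun i j => sph.shear g i j * sph.shear g i j)] at hs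
  have hs' := eq_zero_of_I_sq _ (fun p : Fin 3 × Fin 3 => sph.shear g p.1 p.2) hs
  have hσ : ∀ i j, sph.shear g i j = 0 := fun i j => hs' (i, j) (by simp)
  obtain ⟨k, hk⟩ := exists_eq_algebraMap (F := sph.lap g + 2 * g) fun i => by
    rw [← sph.div2_shear, SphereCalculus.div2]
    simp only [hσ, map_zero, mul_zero, Finset.sum_const_zero]
  have hk' : sph.lap g + 2 * g = 2 * algebraMap ℝ SmoothFn (k / 2) := by
    rw [hk, ← map_ofNat (algebraMap ℝ SmoothFn) 2, ← map_mul]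
    congr 1; ring
  -- If `g = k/2 + a·x`, then `a_i = d_i g + X_i (g - k/2)`. Vanishing shear makes this expression
  -- constant, and contracting it with `X` recovers `g`.
  have hW := sph.d_of_shear_eq_zero (fun i => (sph.d i).map_algebraMap (k / 2)) hk' hσ
  have hW' : ∀ i, ∃ a, sph.d i g + sph.X i * (g - algebraMap ℝ SmoothFn (k / 2)) =
      algebraMap ℝ SmoothFn a := fun i => exists_eq_algebraMap fun j => by
    refine ext_ev fun x => ?_
    have := congrArg (ev x) (hW i j)
    rw [map_mul, map_ofNat, map_zero, mul_eq_zero] at this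
    rw [map_zero]
    exact this.resolve_left two_ne_zero
  choose a ha using hW'
  have hgx : ∀ x, g x = k / 2 + ∑ i, (x : E3) i * a i := by
    intro x
    have e : g = algebraMap ℝ SmoothFn (k / 2) + ∑ i, sph.X i * algebraMap ℝ SmoothFn (a i) := by
      have hX := sph.sum_X_sq
      have hd := sph.sum_X_d g
      simp only [← ha, Fin.sum_univ_three] at hX hd ⊢
      linear_combination -hd - (g - algebraMap ℝ SmoothFn (k / 2)) * hX
    rw [← ev_apply, e]
    simp only [map_add, map_sum, map_mul, AlgHom.commutes, ev_X, Algebra.algebraMap_self,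
      RingHom.id_apply]
  obtain ⟨nA, α, -, hnA⟩ := IsDipole.exists_isLinear
    (n := fun x => inner ℝ (WithLp.toLp 2 a : E3) (x : E3)) ⟨WithLp.toLp 2 a, fun _ => rfl⟩
  have h1' := h1 _ ⟨WithLp.toLp 2 a, fun _ => rfl⟩
  -- Since `g` is a constant plus a dipole and is orthogonal to both, `∫ g² = 0`. The one-term sum
  -- fits `eq_zero_of_I_sq`.
  have hI : sph.I (∑ _i ∈ ({0} : Finset (Fin 1)), g * g) = 0 := by
    rw [Finset.sum_singleton]
    have e : g * g = (k / 2) • g + g * nA := by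
      refine ext_ev fun x => ?_
      simp only [map_add, map_mul, map_smul, smul_eq_mul, ev_apply, hnA]
      nth_rewrite 1 [hgx x]
      simp [PiLp.inner_apply]
      ring
    have h0' : sint g = 0 := h0
    rw [e, map_add, map_smul, I_eq, I_eq, h0', smul_zero, zero_add]
    simp only [← hnA] at h1'
    exact h1'
  exact eq_zero_of_I_sq _ (fun _ => g) hI 0 (by simp)

theorem IsElectricPotential.unique {T : S2 → Fin 3 → Fin 3 → ℝ} {c c' : S2 → ℝ}
    (h : IsElectricPotential T c) (h' : IsElectricPotential T c') : c = c' := by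
  let cA : SmoothFn := ⟨c, h.smooth⟩
  let cA' : SmoothFn := ⟨c', h'.smooth⟩
  have e1 : ∀ n : S2 → ℝ, (fun x => (cA - cA' : SmoothFn) x * n x) =
      fun x => c x * n x - c' x * n x := fun n => funext fun x => sub_mul _ _ _
  have h0 : cA - cA' = 0 := by
    refine eq_zero_of_lapLap ?_ ?_ ?_
    · refine ext_ev fun x => ?_
      have e : sph.lap (sph.lap (cA - cA') + 2 * (cA - cA')) =
          sph.lap (sph.lap cA + 2 * cA) - sph.lap (sph.lap cA' + 2 * cA') := by
        simp only [mul_sub, SphereCalculus.lap_sub, SphereCalculus.lap_add]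
        ring
      rw [e, map_sub, ev_lapLap, ev_lapLap, map_zero, sub_eq_zero]
      exact (h.eq x).trans (h'.eq x).symm
    · change sph.I (cA - cA') = 0
      rw [map_sub]
      exact sub_eq_zero.mpr (h.noMonopole.trans h'.noMonopole.symm)
    · intro n hn
      obtain ⟨nA, α, -, hnA⟩ := hn.exists_isLinear
      have k1 := h.noDipole n hn
      have k2 := h'.noDipole n hn
      simp only [← hnA] at k1 k2 ⊢
      change sph.I ((cA - cA') * nA) = 0
      rw [sub_mul, map_sub]
      exact sub_eq_zero.mpr (k1.trans k2.symm)
  funext x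
  exact congrArg (fun F : SmoothFn => F x) (sub_eq_zero.mp h0)

theorem IsElectricPotential.electricPotential_eq {T : S2 → Fin 3 → Fin 3 → ℝ} {c : S2 → ℝ}
    (h : IsElectricPotential T c) : electricPotential T = c := by
  have hex : ∃ c, IsElectricPotential T c := ⟨c, h⟩
  rw [electricPotential, dif_pos hex]
  exact hex.choose_spec.unique h

/-- The double divergence of a tensor field in terms of its potentials. -/
theorem sum_cov1_div2 (c b : SmoothFn) :
    ∑ i, sph.cov1 (sph.div2 fun i j => sph.shear c i j + sph.dualShear b i j) i i =
      sph.lap (sph.lap c + 2 * c) := by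
  have e : (sph.div2 fun i j => sph.shear c i j + sph.dualShear b i j) = fun i =>
      sph.d i (sph.lap c + 2 * c) + sph.dual (fun j => sph.d j (sph.lap b + 2 * b)) i := by
    funext i
    rw [SphereCalculus.div2_add, SphereCalculus.div2_shear, SphereCalculus.div2_dualShear]
  simp only [e, SphereCalculus.cov1_add, Finset.sum_add_distrib]
  rw [SphereCalculus.sum_cov1_dual_d, add_zero]
  rfl

theorem shear_sub (c f : SmoothFn) (i j : Fin 3) :
    sph.shear (c - f) i j = sph.shear c i j - sph.shear f i j := by
  simp only [SphereCalculus.shear, SphereCalculus.hess_eq, SphereCalculus.lap_sub, map_sub]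
  ring

theorem lap_algebraMap (r : ℝ) : sph.lap (algebraMap ℝ SmoothFn r) = 0 := by
  simp [SphereCalculus.lap_eq]

theorem shear_add_algebraMap (c : SmoothFn) (r : ℝ) (i j : Fin 3) :
    sph.shear (c + algebraMap ℝ SmoothFn r) i j = sph.shear c i j := by
  simp only [SphereCalculus.shear, SphereCalculus.hess_eq, SphereCalculus.lap_add,
    lap_algebraMap, map_add, Derivation.map_algebraMap, add_zero]

/-- Functions without `l = 0, 1` parts that are potentials of a tensor field give its electric
potential. -/
theorem isElectricPotential_of_eq {T : S2 → Fin 3 → Fin 3 → ℝ} (c b : SmoothFn)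
    (h0 : NoMonopolePart c) (h1 : NoDipolePart c)
    (hT : ∀ x i j, T x i j = ev x (sph.shear c i j + sph.dualShear b i j)) :
    IsElectricPotential T c where
  smooth := c.smooth
  noMonopole := h0
  noDipole := h1
  eq x := by
    have e : T = fun y a b' => ev y ((fun i j => sph.shear c i j + sph.dualShear b i j) a b') := by
      funext x i j; exact hT x i j
    rw [e, ← ev_divdiv, sum_cov1_div2, ev_lapLap]

/-- A dipole is an eigenfunction of `D²` with nonzero eigenvalue, and a Laplacian has zero integral.
-/
theorem sint_dipole {n : S2 → ℝ} (hn : IsDipole n) : sint n = 0 := by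
  obtain ⟨nA, α, hl, hnA⟩ := hn.exists_isLinear
  have h := sph.I_mul_lap 1 nA
  have h1 : sph.dot 1 nA = 0 := by simp [SphereCalculus.dot]
  rw [h1, hl.lap_eq, one_mul, map_neg, map_zero, neg_zero, neg_eq_zero, two_mul, map_add] at h
  have h2 : sph.I nA = 0 := by linarith
  rwa [I_eq, show (nA : S2 → ℝ) = n from funext hnA] at h2

theorem sint_one_ne_zero : sint (fun _ => 1) ≠ 0 := by
  have : NeZero (volume : Measure E3).toSphere := ⟨Measure.toSphere_ne_zero _⟩
  rw [sint, integral_const, smul_eq_mul, mul_one]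
  exact measureReal_univ_pos.ne'

/-! ### The angular momentum and its invariance. -/

/-- The angular momentum of smooth data as an integral in the ring of smooth functions. -/
theorem angMomWith_eq {χ : S2 → Fin 3 → Fin 3 → ℝ} {m : S2 → ℝ} {N : S2 → Fin 3 → ℝ} {n c : S2 → ℝ}
    (χA : Fin 3 → Fin 3 → SmoothFn) (mA : SmoothFn) (NA : Fin 3 → SmoothFn) (nA cA : SmoothFn)
    (hχ : ∀ x i j, χ x i j = ev x (χA i j)) (hm : ∀ x, m x = ev x mA)
    (hN : ∀ x i, N x i = ev x (NA i)) (hn : ∀ x, n x = ev x nA) (hc : ∀ x, c x = ev x cA) :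
    angMomWith χ m N n c = -(1 / (8 * Real.pi)) * sph.I (∑ i, sph.dual (fun k => sph.d k nA) i *
        (3 * NA i + (1 / 4 : ℝ) • ∑ j, χA i j * sph.div2 χA j))
      + 3 / (8 * Real.pi) * sph.I (mA * ∑ i, sph.dual (fun k => sph.d k nA) i * sph.d i cA) := by
  have eχ : χ = fun x i j => ev x (χA i j) := by funext x i j; exact hχ x i j
  have en : n = nA := funext hn
  have ec : c = cA := funext hc
  rw [angMomWith, angMomCJK, I_eq, I_eq]
  congr 3
  · funext x
    rw [← ev_apply]
    simp only [map_sum, map_mul, map_add, map_smul, smul_eq_mul, map_ofNat, ev_dual_d, ev_div2, ← hN,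
      en, eχ]
    refine Finset.sum_congr rfl fun i _ => ?_
    rw [Finset.sum_mul]
    exact Finset.sum_congr rfl fun k _ => by ring
  · funext x
    rw [← ev_apply]
    simp only [map_sum, map_mul, ev_dual_d, ev_d, ← hm, en, ec]
    congr 1
    refine Finset.sum_congr rfl fun i _ => ?_
    rw [Finset.sum_mul]
    rfl

theorem contMDiff_slice {I : Set ℝ} (hI : IsOpen I) {u : ℝ} (hu : u ∈ I) {F : ℝ × S2 → ℝ}
    (hF : ContMDiffOn (𝓘(ℝ, ℝ).prod (𝓡 2)) 𝓘(ℝ, ℝ) ∞ F (I ×ˢ univ)) :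
    Smooth fun x => F (u, x) := fun x => by
  have h := (hF (u, x) ⟨hu, mem_univ x⟩).contMDiffAt
    ((hI.prod isOpen_univ).mem_nhds ⟨hu, mem_univ x⟩)
  exact ContMDiffAt.comp (I' := 𝓘(ℝ, ℝ).prod (𝓡 2)) x h
    (contMDiffAt_const.prodMk contMDiffAt_id)

theorem ScriData.χddot_eq_zero {I : Set ℝ} (hI : IsOpen I) {D : ScriData}
    (hχ : ∀ u ∈ I, ∀ x i j, D.χdot u x i j = 0) {u : ℝ} (hu : u ∈ I) (x : S2) (i j : Fin 3) :
    D.χddot u x i j = 0 := by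
  have : (fun s => D.χdot s x i j) =ᶠ[nhds u] fun _ => 0 := by
    filter_upwards [hI.mem_nhds hu] with s hs using hχ s hs x i j
  rw [ScriData.χddot, this.deriv_eq, deriv_const]

theorem div2_zero (x : S2) (i : Fin 3) : div2 (fun _ _ _ => 0) x i = 0 := by
  simp [div2, cov2, pd_const]

end NullInfinity

end

open NullInfinity in
theorem mainTheorem2 (I : Set ℝ) (hI : IsOpen I) (D : NullInfinity.ScriData)
    (hD : D.IsRegularOn I)
    (hχ : ∀ u ∈ I, ∀ x i j, D.χdot u x i j = 0)
    (n : NullInfinity.S2 → ℝ) (hn : NullInfinity.IsDipole n)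
    (f : NullInfinity.S2 → ℝ) (hf : NullInfinity.Smooth f)
    (u : ℝ) (hu : u ∈ I)
    (c b : NullInfinity.S2 → ℝ) (hcb : NullInfinity.ArePotentials (D.χ u) c b)
    (horth : NullInfinity.sint (fun x => f x *
      ∑ i, NullInfinity.grad n x i * NullInfinity.grad (NullInfinity.lapLap b) x i) = 0) :
    (NullInfinity.NoDipolePart f →
      (D.supertranslate f).angMom n u = D.angMom n u) ∧
    NullInfinity.angMomWith ((D.supertranslate f).χ u) ((D.supertranslate f).m u)
      ((D.supertranslate f).N u) n (fun x => c x - f x) = D.angMom n u := by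
  obtain ⟨nA, α, hnl, hnA⟩ := hn.exists_isLinear
  let cA : SmoothFn := ⟨c, hcb.smooth_c⟩
  let bA : SmoothFn := ⟨b, hcb.smooth_b⟩
  let fA : SmoothFn := ⟨f, hf⟩
  let mA : SmoothFn := ⟨D.m u, contMDiff_slice hI hu hD.smooth_m⟩
  let NA : Fin 3 → SmoothFn := fun i => ⟨fun x => D.N u x i, contMDiff_slice hI hu (hD.smooth_N i)⟩
  let χA : Fin 3 → Fin 3 → SmoothFn := fun i j => sph.shear cA i j + sph.dualShear bA i j
  have ev_shear : ∀ (F : SmoothFn) x i j, ev x (sph.shear F i j) =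
      2 * hess F x i j - met x i j * lap F x := fun F x i j => by
    rw [SphereCalculus.shear, map_sub, map_mul, map_mul, map_ofNat, ev_hess, ev_met, ev_lap]
  have hχA : ∀ x i j, D.χ u x i j = ev x (χA i j) := fun x i j => by
    rw [hcb.eq]
    simp only [χA, map_add, ev_shear, SphereCalculus.dualShear, map_sum, map_mul, ev_eps, ev_hess]
    exact add_assoc _ _ _
  have hdot : D.χdot u = fun _ _ _ => 0 := by funext x i j; exact hχ u hu x i j
  have hddot : D.χddot u = fun _ _ _ => 0 := by
    funext x i j; exact ScriData.χddot_eq_zero hI hχ hu x i j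
  let χA' : Fin 3 → Fin 3 → SmoothFn := fun i j => χA i j - sph.shear fA i j
  let curl : Fin 3 → SmoothFn := fun i => ∑ k, sph.d k fA * sph.cov1 (sph.div2 χA) i k
    - ∑ k, sph.d k fA * sph.cov1 (sph.div2 χA) k i
  let NA' : Fin 3 → SmoothFn := fun i => NA i - mA * sph.d i fA + (1 / 4 : ℝ) • curl i
  have hχA' : ∀ x i j, (D.supertranslate f).χ u x i j = ev x (χA' i j) := fun x i j => by
    simp only [χA', map_sub, ev_shear, ← hχA]
    change D.χ u x i j - 2 * hess f x i j + met x i j * lap f x =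
      D.χ u x i j - (2 * hess f x i j - met x i j * lap f x)
    ring
  have hm' : ∀ x, (D.supertranslate f).m u x = ev x mA := fun x => by
    simp only [ScriData.supertranslate, hdot, hddot, div2_zero]
    simp
    rfl
  have hN' : ∀ x i, (D.supertranslate f).N u x i = ev x (NA' i) := fun x i => by
    simp only [ScriData.supertranslate, hdot, hddot, div2_zero]
    simp only [NA', curl, map_add, map_sub, map_mul, map_smul, map_sum, ev_cov1, ev_div2, ev_d,
      ← hχA, smul_eq_mul, mul_zero, zero_mul, Finset.sum_const_zero, sub_zero, add_zero]
    rw [mul_sub, ← add_sub_assoc]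
    rfl
  have hJ := angMomWith_eq χA mA NA nA cA hχA (fun _ => rfl) (fun _ _ => rfl)
    (fun x => (hnA x).symm) (fun _ => rfl) (m := D.m u) (N := D.N u) (c := c)
  have hJ' := angMomWith_eq χA' mA NA' nA (cA - fA) hχA' hm' hN' (fun x => (hnA x).symm)
    (c := fun x => c x - f x) (fun x => by rw [map_sub]; rfl)
  have hEc : electricPotential (D.χ u) = c :=
    (isElectricPotential_of_eq cA bA hcb.noMonopole_c hcb.noDipole_c hχA).electricPotential_eq
  -- The only use of the orthogonality condition.
  have hvar : sph.I (∑ i, sph.dual (fun k => sph.d k nA) i * (3 * curl i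
      + ∑ j, χA' i j * sph.div2 χA' j - ∑ j, χA i j * sph.div2 χA j)) = 0 := by
    have h := sph.I_shear_variation hnl fA cA bA (χ := χA) rfl
    have hdiv : ∀ j, sph.div2 χA' j = sph.div2 χA j - sph.d j (sph.lap fA + 2 * fA) := fun j => by
      rw [← SphereCalculus.div2_shear]
      exact sph.div2_sub χA (sph.shear fA) j
    simp only [hdiv]
    refine h.trans (neg_eq_zero.mpr ?_)
    rw [I_eq, ← horth]
    congr 1
    funext x
    rw [← ev_apply]
    have e : lapLap b = (sph.lap (sph.lap bA + 2 * bA) : SmoothFn) := by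
      funext x; exact (ev_lapLap x bA).symm
    rw [e, show n = nA from (funext hnA).symm]
    simp only [SphereCalculus.dot, map_mul, map_sum, ev_d]
    rfl
  have key : angMomWith ((D.supertranslate f).χ u) ((D.supertranslate f).m u)
      ((D.supertranslate f).N u) n (fun x => c x - f x) = D.angMom n u := by
    rw [ScriData.angMom, hEc, hJ', hJ]
    -- The term with `mA` arises from `-m f_A` in the new `N` and cancels against the change of `c`
    -- in `e2`.
    have e1 : ∑ i, sph.dual (fun k => sph.d k nA) i *
        (3 * NA' i + (1 / 4 : ℝ) • ∑ j, χA' i j * sph.div2 χA' j) =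
        ∑ i, sph.dual (fun k => sph.d k nA) i *
          (3 * NA i + (1 / 4 : ℝ) • ∑ j, χA i j * sph.div2 χA j)
        - (3 : ℝ) • (mA * ∑ i, sph.dual (fun k => sph.d k nA) i * sph.d i fA)
        + (1 / 4 : ℝ) • ∑ i, sph.dual (fun k => sph.d k nA) i * (3 * curl i
          + ∑ j, χA' i j * sph.div2 χA' j - ∑ j, χA i j * sph.div2 χA j) := by
      simp only [Finset.mul_sum _ _ mA, Finset.smul_sum, ← Finset.sum_sub_distrib,
        ← Finset.sum_add_distrib]
      refine Finset.sum_congr rfl fun i _ => ext_ev fun x => ?_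
      simp only [NA', ← Finset.smul_sum, map_add, map_sub, map_mul, map_smul, smul_eq_mul, map_ofNat]
      ring
    have e2 : mA * ∑ i, sph.dual (fun k => sph.d k nA) i * sph.d i (cA - fA) =
        mA * ∑ i, sph.dual (fun k => sph.d k nA) i * sph.d i cA
        - mA * ∑ i, sph.dual (fun k => sph.d k nA) i * sph.d i fA := by
      simp only [map_sub, mul_sub, Finset.sum_sub_distrib]
    rw [e1, e2, map_add, map_sub, map_sub, map_smul, map_smul, hvar, smul_zero, smul_eq_mul]
    ring
  refine ⟨fun hfd => ?_, key⟩
  rw [← key, ScriData.angMom]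
  -- The mean of `f`: adding it to `c - f` removes the `l = 0` part without changing the shear. The
  -- absence of an `l = 1` part is where the assumption on `f` enters.
  let κ : ℝ := sint f / sint fun _ => 1
  let gA : SmoothFn := cA - fA + algebraMap ℝ SmoothFn κ
  have hI1 : ∀ F : SmoothFn, sph.I (algebraMap ℝ SmoothFn κ * F) = κ * sph.I F := fun F => by
    rw [← Algebra.smul_def, map_smul, smul_eq_mul]
  have hpot : IsElectricPotential ((D.supertranslate f).χ u) gA := by
    refine isElectricPotential_of_eq gA bA ?_ ?_ fun x i j => ?_
    · change sph.I (cA - fA + algebraMap ℝ SmoothFn κ) = 0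
      rw [← mul_one (algebraMap ℝ SmoothFn κ), map_add, map_sub, hI1]
      have h1 : sph.I cA = 0 := hcb.noMonopole_c
      have h2 : κ * sph.I 1 = sint f := div_mul_cancel₀ _ sint_one_ne_zero
      rw [h1, h2]
      exact (zero_sub (sint f)).symm ▸ neg_add_cancel _
    · intro n' hn'
      obtain ⟨nA', α', -, hnA'⟩ := hn'.exists_isLinear
      have h1 := hcb.noDipole_c n' hn'
      have h2 := hfd n' hn'
      have h3 := sint_dipole hn'
      rw [show n' = nA' from (funext hnA').symm] at h1 h2 h3 ⊢
      change sph.I ((cA - fA + algebraMap ℝ SmoothFn κ) * nA') = 0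
      rw [add_mul, sub_mul, map_add, map_sub, hI1]
      have k1 : sph.I (cA * nA') = 0 := h1
      have k2 : sph.I (fA * nA') = 0 := h2
      have k3 : sph.I nA' = 0 := h3
      rw [k1, k2, k3]
      ring
    · rw [hχA']
      congr 1
      simp only [χA', χA, gA, shear_add_algebraMap, shear_sub]
      ring
  rw [hpot.electricPotential_eq, hJ', angMomWith_eq χA' mA NA' nA gA hχA' hm' hN'
    (fun x => (hnA x).symm) (c := gA) (fun _ => rfl)]
  -- The potential enters `J` only through its gradient, so the constant `κ` disappears.
  simp only [gA, map_add (sph.d _), Derivation.map_algebraMap, add_zero]
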